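/- **Theorem 3.6 (Consistency).** Let $X$ be a real Banach space, let $A$ be the generator of a $C_0$ semigroup on $X$, and for each $g\in X$ let $B(g)$ be an (unbounded) linear operator on $X$. Let $f\in C^1([0,T],X)$ be a classical solution of $f'(t)=Af(t)+B(f(t))f(t)$ on $[0,T]$, and suppose that $B(f(t))$ generates a $C_0$ semigroup for every $t\in[0,T]$. *Notation.* $E_B(r,u_0)$ is the value at time $r$ of the classical ($C^1$) solution of $g'=B(g)g$, $g(0)=u_0$; it is defined on the set $D_r$ of those $u_0$ for which a solution exists on $[0,r]$ and is unique on each $[0,r']$, $r'\le r$. $\partial_2E_B(r,u)$ is the bounded linear operator that is the Hadamard derivative of $E_B(r,\cdot)$ on $D_r$ at $u$, i.e. $c_n^{-1}\bigl(E_B(r,u+c_nd_n)-E_B(r,u)\bigr)\to\partial_2E_B(r,u)g$ whenever $c_n\downarrow0$, $d_n\to g$, $u+c_nd_n\in D_r$. $B'(g)x=\frac{\mathrm d}{\mathrm dh}B(u+hg)x|_{h=0}$ is taken at the base point $u=f_0$ below. Further, $\varphi_k(\tau E)=\int_0^1e^{(1-\theta)\tau E}\frac{\theta^{k-1}}{(k-1)!}\,\mathrm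 d\theta$ for $k\ge1$; $R_k(g)=\frac1{(k-1)!}\int_0^1g^{(k)}(\tau s)(1-s)^{k-1}\,\mathrm ds$ is the remainder in the Taylor expansion $g(\tau)=\sum_{j<k}\frac{\tau^j}{j!}g^{(j)}(0)+\tau^kR_k(g)$; in $R_k(\partial_2E_B(\cdot,f_0))x$ one expands $r\mapsto\partial_2E_B(r,f_0)x$. Finally $\{E_1,E_2\}=E_1E_2+E_2E_1$, products and sums of operators have their natural domains, and $\delta_{ij}$ is the Kronecker delta. *Regularity.* Suppose that $E_B$ is well defined and continuously differentiable along $f$: for all $r,s\ge0$ with $r+s\le T$, $f(s)\in D_r$, the tangent directions of $D_r$ at $f(s)$ span a dense subspace, $\partial_2E_B(r,f(s))$ exists, and on this set of $(r,s)$ the function $\partial_1E_B(r,f(s))=B(E_B(r,f(s)))E_B(r,f(s))$ is continuous and $\partial_2E_B(r,f(s))$ is strongly continuous. For each $t\in[0,T)$, with $g=Af(t)$, suppose moreover that there is $\varepsilon>0$ such that, for $|h|<\varepsilon$ and $0\le r\le\varepsilon$, $f(t)+hg\in D_\varepsilon$, the operator $\partial_2E_B(r,f(t)+hg)$ exists,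 and the mixed derivative $\frac{\partial}{\partial r}\bigl(\partial_2E_B(r,f(t)+hg)g\bigr)$ exists and is continuous in $(r,h)$; and that for $h$ near $0$ the elements $B(f(t)+hg)f(t)$ and $B(f(t)+hg)g$ are defined, the first being differentiable and the second continuous in $h$ at $h=0$. *Estimates.* For $t\in[0,T)$ and $0<\tau\le T-t$ write $f_0=f(t)$, $\widetilde B=B(f(t+\frac\tau2))$, $u(s)=E_B(s,f_0)$. Suppose that there is a constant $C$ such that for all such $t$ and $\tau$ the following expressions are well defined (all elements lie in the domains of the operators applied to them, and the indicated derivatives exist, on the closed ranges indicated; in (7), $r\mapsto\partial_2E_B(r,f_0)Af_0$ is $C^2$ and $r\mapsto\partial_2E_B(r,f_0)A^2f_0$ is $C^1$ on $[0,\tau]$) and satisfy: 1. $\|(B(u(\frac\tau2))-\widetilde B)\,R_1(u)\|\le C\tau$, where here $R_1(u)=\int_0^1u'(\frac\tau2s)\,\mathrm ds$, and $\|\widetilde B\varphi_1(\frac\tau2\widetilde B)(B(u(\frac\tau2))-\widetilde B)u(\frac\tau2)\|\le C\tau$; 2. $\sup_{0\le s\le\tau}\|\frac{\mathrm d^2}{\mathrm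 ds^2}\,e^{(\tau-s)\widetilde B}(B(u(s))-\widetilde B)u(s)\|\le C$; 3. $\|[B(u(\frac\tau2))-\widetilde B+\frac\tau2B'(Af_0)]f_0\|\le C\tau^2$; 4. $\sup_{0\le s\le\tau}\|A^ie^{(\tau-s)\widetilde B}(B(u(s))-\widetilde B)u(s)\|\le C\tau^{2-i}$, $i\in\{1,2\}$; 5. $\|(B(f_0)-\widetilde B)Af_0\|\le C\tau$; 6. $\|A^{\delta_{i2}}\widetilde B^{1+\delta_{i0}}\varphi_{1+\delta_{i0}}(\tau\widetilde B)A^{1+\delta_{i1}}f_0\|\le C$, $i\in\{0,1,2\}$; 7. $\|A^{\delta_{i2}}R_{1+\delta_{i0}}(\partial_2E_B(\cdot,f_0))A^{1+\delta_{i1}}f_0\|\le C$, $i\in\{0,1,2\}$; 8. $\sup_{0\le s\le\tau}\|\frac{\mathrm d^2}{\mathrm ds^2}\bigl(\partial_2E_B(\tau-s,f(t+s))Au(s)\bigr)\|\le C$; 9. $\sup_{0\le\sigma\le s\le\tau}\|\frac{\partial}{\partial s}k(s,\sigma)\|\le C$ and $\sup_{0\le\sigma\le s\le\tau}\|\frac{\partial}{\partial\sigma}k(s,\sigma)\|\le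 C$, where $k(s,\sigma)=\partial_2E_B(\tau-s,f(t+s))\,A\,\partial_2E_B(s-\sigma,f(t+\sigma))\,A\,u(\sigma)$; 10. $\bigl\|\bigl(\prod_{k=0}^2\partial_2E_B(\sigma_k-\sigma_{k+1},f(t+\sigma_{k+1}))A\bigr)f(t+\sigma_3)\bigr\|\le C$ for $0\le\sigma_3\le\sigma_2\le\sigma_1\le\sigma_0=\tau$ (factors ordered from left to right); 11. $\sup_{0\le s\le\tau}\|\{A,\{A,\{A,e^{\frac s2A}e^{\tau\widetilde B}e^{\frac s2A}\}\}\}f_0\|\le C$. *Conclusion.* The Strang splitting is consistent of order $2$: there is a constant $C'$ such that for all $\tau>0$ and $k\in\{0,1,2,\dots\}$ with $(k+1)\tau\le T$, with $t_k=k\tau$, $$\bigl\|f(t_k+\tau)-e^{\frac\tau2A}e^{\tau B(f(t_k+\frac\tau2))}e^{\frac\tau2A}f(t_k)\bigr\|\le C'\tau^3 .$$ -/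

import Mathlib

open Filter Topology Set
open scoped NNReal Nat

noncomputable section

namespace StrangSplitting

variable {X : Type*} [NormedAddCommGroup X] [NormedSpace ℝ X]

/-! ### Unbounded operators

An unbounded linear operator on `X` is a partially defined linear map `X →ₗ.[ℝ] X`; sums and
differences are those of Mathlib, with domain the intersection of the two domains. -/

/-- The value `E x`, with the junk value `0` outside of the domain. -/
def app (E : X →ₗ.[ℝ] X) (x : X) : X :=
  open Classical in if h : x ∈ E.domain then E ⟨x, h⟩ else 0

/-- The product `E F` on its natural domain `{x ∈ D(F) | F x ∈ D(E)}`. -/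
def opMul (E F : X →ₗ.[ℝ] X) : X →ₗ.[ℝ] X where
  domain := (E.domain.comap F.toFun).map F.domain.subtype
  toFun :=
    { toFun := fun x => E ⟨F ⟨x.1, by obtain ⟨y, -, h⟩ := x.2; exact h ▸ y.2⟩, by
        obtain ⟨_, y, hy, rfl⟩ := x; exact hy⟩
      map_add' := by
        intro x y
        rw [← E.map_add]
        congr 1
        ext
        exact F.map_add ⟨x.1, _⟩ ⟨y.1, _⟩
      map_smul' := by
        intro c x
        rw [RingHom.id_apply, ← E.map_smul]
        congr 1
        ext
        exact F.map_smul c ⟨x.1, _⟩ }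

infixr:72 " ⬝ₒ " => opMul

/-- An everywhere defined linear map, regarded as a partially defined one. -/
def total (L : X →ₗ[ℝ] X) : X →ₗ.[ℝ] X := L.toPMap ⊤

/-- The anticommutator `{E, F} = E F + F E` on its natural domain. -/
def anticomm (E F : X →ₗ.[ℝ] X) : X →ₗ.[ℝ] X := E ⬝ₒ F + F ⬝ₒ E

/-- The estimate `‖E x‖ ≤ c`, which includes that `E x` is defined. -/
def NormLE (E : X →ₗ.[ℝ] X) (x : X) (c : ℝ) : Prop :=
  x ∈ E.domain ∧ ‖app E x‖ ≤ c

/-! ### Semigroups, exponentials and `φ` functions -/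

/-- Strongly continuous (`C₀`) semigroups of bounded operators on `X`. -/
structure C0Semigroup (X : Type*) [NormedAddCommGroup X] [NormedSpace ℝ X] where
  op : ℝ≥0 → X →L[ℝ] X
  op_zero : op 0 = ContinuousLinearMap.id ℝ X
  op_add : ∀ s t, op (s + t) = (op s).comp (op t)
  continuous_op : ∀ x, Continuous fun t => op t x

/-- `y` is the limit of the difference quotients `(S(h) x - x) / h` as `h → 0+`. -/
def C0Semigroup.HasGen (S : C0Semigroup X) (x y : X) : Prop :=
  Tendsto (fun h : ℝ => h⁻¹ • (S.op h.toNNReal x - x)) (𝓝[>] 0) (𝓝 y)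

theorem C0Semigroup.HasGen.add {S : C0Semigroup X} {x y x' y' : X}
    (h : S.HasGen x y) (h' : S.HasGen x' y') : S.HasGen (x + x') (y + y') := by
  refine (Tendsto.add h h').congr fun t => ?_
  rw [map_add, ← smul_add]
  congr 1
  abel

theorem C0Semigroup.HasGen.smul {S : C0Semigroup X} {x y : X} (c : ℝ)
    (h : S.HasGen x y) : S.HasGen (c • x) (c • y) := by
  refine (Tendsto.const_smul h c).congr fun t => ?_
  rw [map_smul, smul_comm, smul_sub]

theorem C0Semigroup.HasGen.unique {S : C0Semigroup X} {x y y' : X}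
    (h : S.HasGen x y) (h' : S.HasGen x y') : y = y' :=
  tendsto_nhds_unique h h'

/-- The (infinitesimal) generator of a `C₀` semigroup, with its full domain. -/
def C0Semigroup.generator (S : C0Semigroup X) : X →ₗ.[ℝ] X where
  domain :=
    { carrier := {x | ∃ y, S.HasGen x y}
      add_mem' := fun ⟨_, h⟩ ⟨_, h'⟩ => ⟨_, h.add h'⟩
      zero_mem' := ⟨0, by simp [C0Semigroup.HasGen]⟩
      smul_mem' := fun c _ ⟨_, h⟩ => ⟨_, h.smul c⟩ }
  toFun :=
    { toFun := fun x => x.2.choose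
      map_add' := fun x y =>
        (x + y).2.choose_spec.unique (x.2.choose_spec.add y.2.choose_spec)
      map_smul' := fun c x =>
        (c • x).2.choose_spec.unique (x.2.choose_spec.smul c) }

/-- The operator `E` generates a `C₀` semigroup. -/
def Generates (E : X →ₗ.[ℝ] X) : Prop := ∃ S : C0Semigroup X, S.generator = E

/-- `e^{tE}` for `t ≥ 0`, the semigroup generated by `E` (a semigroup is determined by its
generator). The junk values are `0` if `E` is not a generator and `1` for `t < 0`. -/
def expOp (E : X →ₗ.[ℝ] X) (t : ℝ) : X →L[ℝ] X :=
  open Classical in if h : Generates E then h.choose.op t.toNNReal else 0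

theorem continuous_expOp (E : X →ₗ.[ℝ] X) (x : X) : Continuous fun t => expOp E t x := by
  unfold expOp
  split_ifs with h
  · exact (h.choose.continuous_op x).comp continuous_real_toNNReal
  · exact continuous_const

/-- The functions `φ_0(τE) = e^{τE}` and
`φ_k(τE) = ∫_0^1 e^{(1-θ)τE} θ^{k-1} / (k-1)! dθ` for `k ≥ 1`. -/
def phi (E : X →ₗ.[ℝ] X) (τ : ℝ) : ℕ → X →ₗ[ℝ] X
  | 0 => (expOp E τ : X →ₗ[ℝ] X)
  | k + 1 =>
    have hc : ∀ x, Continuous fun θ : ℝ => (θ ^ k / (k ! : ℝ)) • expOp E ((1 - θ) * τ) x :=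
      fun x => ((continuous_id.pow k).div_const _).smul
        ((continuous_expOp E x).comp ((continuous_const.sub continuous_id).mul continuous_const))
    { toFun := fun x => ∫ θ in (0 : ℝ)..1, (θ ^ k / (k ! : ℝ)) • expOp E ((1 - θ) * τ) x
      map_add' := fun x y => by
        rw [← intervalIntegral.integral_add ((hc x).intervalIntegrable _ _)
          ((hc y).intervalIntegrable _ _)]
        simp only [map_add, smul_add]
      map_smul' := fun c x => by
        rw [RingHom.id_apply, ← intervalIntegral.integral_smul]
        simp only [map_smul, smul_comm c] }

/-! ### Taylor remainders and bounds on derivatives -/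

/-- The remainder `R_k(g)` in
`g(τ) = g(0) + τ g'(0) + … + τ^{k-1} g^{(k-1)}(0) / (k-1)! + τ^k R_k(g)`:
`R_0(g) = g(τ)`, and `R_k(g) = 1/(k-1)! ∫_0^1 g^{(k)}(τs) (1-s)^{k-1} ds` for `k ≥ 1`. -/
def taylorRem (k : ℕ) (g : ℝ → X) (τ : ℝ) : X :=
  if k = 0 then g τ else
    ((k - 1)! : ℝ)⁻¹ •
      ∫ s in (0 : ℝ)..1, (1 - s) ^ (k - 1) • iteratedDerivWithin k g (Icc 0 τ) (τ * s)

/-- `g` is differentiable on `[a, b]` with derivative bounded by `c`. -/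
def DerivLE (g : ℝ → X) (a b c : ℝ) : Prop :=
  DifferentiableOn ℝ g (Icc a b) ∧ ∀ s ∈ Icc a b, ‖derivWithin g (Icc a b) s‖ ≤ c

/-- `g` is twice differentiable on `[a, b]` with second derivative bounded by `c`. -/
def SecondDerivLE (g : ℝ → X) (a b c : ℝ) : Prop :=
  DifferentiableOn ℝ g (Icc a b) ∧ DerivLE (derivWithin g (Icc a b)) a b c

/-! ### Evolution equations -/

/-- `u` is a classical (continuously differentiable) solution of the quasi-linear equation
`u'(t) = G(u(t)) u(t)` on `[0, r]`. -/
structure IsSolution (G : X → X →ₗ.[ℝ] X) (r : ℝ) (u : ℝ → X) : Prop where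
  mem_domain : ∀ t ∈ Icc 0 r, u t ∈ (G (u t)).domain
  hasDeriv : ∀ t ∈ Icc 0 r, HasDerivWithinAt u (app (G (u t)) (u t)) (Icc 0 r) t
  continuous_deriv : ContinuousOn (fun t => app (G (u t)) (u t)) (Icc 0 r)

/-- The initial values `u₀` for which `u' = G(u) u`, `u(0) = u₀` has a unique solution up to
time `r`: a solution on `[0, r]` exists, and it is unique on each `[0, r']` with `r' ≤ r`. -/
def wellPosed (G : X → X →ₗ.[ℝ] X) (r : ℝ) : Set X :=
  {u₀ | (∃ u, IsSolution G r u ∧ u 0 = u₀) ∧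
    ∀ r' ∈ Icc 0 r, ∀ u v, IsSolution G r' u → IsSolution G r' v → u 0 = u₀ → v 0 = u₀ →
      EqOn u v (Icc 0 r')}

/-- The evolution operator `E_G(t, u₀)`: the value at time `t` of the solution of `u' = G(u) u`
with `u(0) = u₀`. -/
def evol (G : X → X →ₗ.[ℝ] X) (t : ℝ) (u₀ : X) : X :=
  open Classical in if h : ∃ u, IsSolution G t u ∧ u 0 = u₀ then h.choose t else 0

/-- The bounded linear operator `L` is the Hadamard derivative of `F` at `u` within `S`:
`(F(u + c_n d_n) - F(u)) / c_n → L g` whenever `c_n → 0+`, `d_n → g` and `u + c_n d_n ∈ S`. -/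
def HasHadamardDerivWithinAt (F : X → X) (L : X →L[ℝ] X) (S : Set X) (u : X) : Prop :=
  ∀ (g : X) (c : ℕ → ℝ) (d : ℕ → X), (∀ n, 0 < c n) → Tendsto c atTop (𝓝 0) →
    Tendsto d atTop (𝓝 g) → (∀ n, u + c n • d n ∈ S) →
    Tendsto (fun n => (c n)⁻¹ • (F (u + c n • d n) - F u)) atTop (𝓝 (L g))

/-- `E_G(r, ·)` is differentiable at `u` (in the sense of Hadamard, within its domain). -/
def EvolDifferentiableAt (G : X → X →ₗ.[ℝ] X) (r : ℝ) (u : X) : Prop :=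
  ∃ L, HasHadamardDerivWithinAt (evol G r) L (wellPosed G r) u

/-- `∂₂E_G(r, u)`, the derivative of the evolution operator with respect to the initial value. -/
def evolDeriv (G : X → X →ₗ.[ℝ] X) (r : ℝ) (u : X) : X →L[ℝ] X :=
  open Classical in if h : EvolDifferentiableAt G r u then h.choose else 0

/-- The bounded operator `∂₂E_G(r, u)` as a partially defined one, for use in products. -/
abbrev evolDerivOp (G : X → X →ₗ.[ℝ] X) (r : ℝ) (u : X) : X →ₗ.[ℝ] X :=
  total (evolDeriv G r u : X →ₗ[ℝ] X)

/-- `e^{tE}` as an operator, for use in products. -/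
abbrev expOp' (E : X →ₗ.[ℝ] X) (t : ℝ) : X →ₗ.[ℝ] X := total (expOp E t : X →ₗ[ℝ] X)

/-- `B'(g) x` at the point `u`: the derivative at `h = 0` of `h ↦ B(u + h g) x`. -/
def opDeriv (B : X → X →ₗ.[ℝ] X) (u g x : X) : X :=
  deriv (fun h : ℝ => app (B (u + h • g)) x) 0

/-! ### The setting: the evolution of `B` along the exact solution is continuously differentiable -/

/-- The evolution operator `E_B` exists and is a continuously differentiable function of time and
initial value along the solution `f` of the full problem on `[0, T]`, and `B` is differentiable
along `f`. This is what gives a meaning to `E_B`, `∂₁E_B`, `∂₂E_B`, `∂₁∂₂E_B` and `B'`. -/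
structure RegularAlong (A : X →ₗ.[ℝ] X) (B : X → X →ₗ.[ℝ] X) (T : ℝ) (f : ℝ → X) : Prop where
  /-- `g' = B(g) g` with initial value `f(s)` has a unique solution (up to time `T - s`). -/
  wellPosed : ∀ r s, 0 ≤ r → 0 ≤ s → r + s ≤ T → f s ∈ wellPosed B r
  /-- The derivative with respect to the initial value is unambiguous: the directions tangent to
  the domain of `E_B(r, ·)` span a dense subspace. -/
  uniqueDiff : ∀ r s, 0 ≤ r → 0 ≤ s → r + s ≤ T →
    UniqueDiffWithinAt ℝ (StrangSplitting.wellPosed B r) (f s)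
  /-- `∂₂E_B(r, f(s))` exists. -/
  differentiable : ∀ r s, 0 ≤ r → 0 ≤ s → r + s ≤ T → EvolDifferentiableAt B r (f s)
  /-- `∂₁E_B(r, f(s)) = B(E_B(r, f(s))) E_B(r, f(s))` is continuous in `(r, s)`. -/
  continuous_deriv_fst :
    ContinuousOn (fun p : ℝ × ℝ => app (B (evol B p.1 (f p.2))) (evol B p.1 (f p.2)))
      {p | 0 ≤ p.1 ∧ 0 ≤ p.2 ∧ p.1 + p.2 ≤ T}
  /-- `∂₂E_B(r, f(s))` is strongly continuous in `(r, s)`. -/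
  continuous_deriv_snd : ∀ x,
    ContinuousOn (fun p : ℝ × ℝ => evolDeriv B p.1 (f p.2) x)
      {p | 0 ≤ p.1 ∧ 0 ≤ p.2 ∧ p.1 + p.2 ≤ T}
  /-- The mixed derivative `∂₁∂₂E_B(r, f(t) + h A f(t)) A f(t)` exists and is continuous for small
  `r ≥ 0` and `h`. -/
  mixed_deriv : ∀ t, 0 ≤ t → t < T → ∃ ε > 0, ∃ m : ℝ × ℝ → X,
    (∀ h ∈ Ioo (-ε) ε, f t + h • app A (f t) ∈ StrangSplitting.wellPosed B ε ∧
      ∀ r ∈ Icc 0 ε, EvolDifferentiableAt B r (f t + h • app A (f t)) ∧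
        HasDerivWithinAt (fun ρ => evolDeriv B ρ (f t + h • app A (f t)) (app A (f t)))
          (m (r, h)) (Icc 0 ε) r) ∧
    ContinuousOn m (Icc 0 ε ×ˢ Ioo (-ε) ε)
  /-- `B'(A f(t)) f(t)` exists. -/
  differentiable_op : ∀ t, 0 ≤ t → t < T →
    (∀ᶠ h : ℝ in 𝓝 0, f t ∈ (B (f t + h • app A (f t))).domain) ∧
      DifferentiableAt ℝ (fun h : ℝ => app (B (f t + h • app A (f t))) (f t)) 0
  /-- `B(f(t) + h A f(t)) A f(t)` is continuous in `h` at `h = 0`. -/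
  continuous_op : ∀ t, 0 ≤ t → t < T →
    (∀ᶠ h : ℝ in 𝓝 0, app A (f t) ∈ (B (f t + h • app A (f t))).domain) ∧
      ContinuousAt (fun h : ℝ => app (B (f t + h • app A (f t))) (app A (f t))) 0

/-! ### The estimates -/

/-- The operator bounds, with constant `C`, for one step of size `τ` that starts at time `t`. They
are used only for `f₀ = f(t)`, `Bt = B̃ = B(f(t + τ/2))` and `u(s) = E_B(s, f₀)`: see `Estimates`. -/
structure StepEstimates (A : X →ₗ.[ℝ] X) (B : X → X →ₗ.[ℝ] X) (f : ℝ → X) (t τ C : ℝ)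
    (f₀ : X) (Bt : X →ₗ.[ℝ] X) (u : ℝ → X) : Prop where
  /-- `‖(B(u(τ/2)) - B̃) R_1(u)‖ ≤ C τ`, where `u(τ/2) = f₀ + (τ/2) R_1(u)` -/
  midpoint_zero : NormLE (B (u (τ / 2)) - Bt) (taylorRem 1 u (τ / 2)) (C * τ)
  /-- `‖B̃ φ_1((τ/2)B̃) (B(u(τ/2)) - B̃) u(τ/2)‖ ≤ C τ` -/
  midpoint_one :
    NormLE (Bt ⬝ₒ total (phi Bt (τ / 2) 1) ⬝ₒ (B (u (τ / 2)) - Bt)) (u (τ / 2)) (C * τ)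
  /-- `‖d²/ds² e^{(τ-s)B̃} (B(u(s)) - B̃) u(s)‖ ≤ C` -/
  second_deriv_mem : ∀ s ∈ Icc 0 τ, u s ∈ (B (u s) - Bt).domain
  second_deriv :
    SecondDerivLE (fun s => expOp Bt (τ - s) (app (B (u s) - Bt) (u s))) 0 τ C
  /-- `‖[B(u(τ/2)) - B̃ + (τ/2) B'(A f₀)] f₀‖ ≤ C τ²` -/
  order_zero_mem : f₀ ∈ (B (u (τ / 2)) - Bt).domain
  order_zero :
    ‖app (B (u (τ / 2)) - Bt) f₀ + (τ / 2) • opDeriv B f₀ (app A f₀) f₀‖ ≤ C * τ ^ 2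
  /-- `‖A^i e^{(τ-s)B̃} (B(u(s)) - B̃) u(s)‖ ≤ C τ^{2-i}` for `i = 1, 2` -/
  commute_one : ∀ s ∈ Icc 0 τ,
    NormLE (A ⬝ₒ expOp' Bt (τ - s) ⬝ₒ (B (u s) - Bt)) (u s) (C * τ)
  commute_two : ∀ s ∈ Icc 0 τ,
    NormLE (A ⬝ₒ A ⬝ₒ expOp' Bt (τ - s) ⬝ₒ (B (u s) - Bt)) (u s) C
  /-- `‖(B(f₀) - B̃) A f₀‖ ≤ C τ` -/
  order_one : NormLE ((B f₀ - Bt) ⬝ₒ A) f₀ (C * τ)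
  /-- `‖A^{δ_{i2}} B̃^{1+δ_{i0}} φ_{1+δ_{i0}}(τB̃) A^{1+δ_{i1}} f₀‖ ≤ C` for `i = 0, 1, 2` -/
  phi_zero : NormLE (Bt ⬝ₒ Bt ⬝ₒ total (phi Bt τ 2) ⬝ₒ A) f₀ C
  phi_one : NormLE (Bt ⬝ₒ total (phi Bt τ 1) ⬝ₒ A ⬝ₒ A) f₀ C
  phi_two : NormLE (A ⬝ₒ Bt ⬝ₒ total (phi Bt τ 1) ⬝ₒ A) f₀ C
  /-- `‖A^{δ_{i2}} R_{1+δ_{i0}}(∂₂E_B(·, f₀)) A^{1+δ_{i1}} f₀‖ ≤ C` for `i = 0, 1, 2`; the functions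
  that are expanded are as smooth as their remainders require -/
  rem_zero_smooth : ContDiffOn ℝ 2 (fun r => evolDeriv B r f₀ (app A f₀)) (Icc 0 τ)
  rem_zero : ‖taylorRem 2 (fun r => evolDeriv B r f₀ (app A f₀)) τ‖ ≤ C
  rem_one_mem : f₀ ∈ (A ⬝ₒ A).domain
  rem_one_smooth : ContDiffOn ℝ 1 (fun r => evolDeriv B r f₀ (app (A ⬝ₒ A) f₀)) (Icc 0 τ)
  rem_one : ‖taylorRem 1 (fun r => evolDeriv B r f₀ (app (A ⬝ₒ A) f₀)) τ‖ ≤ C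
  rem_two : NormLE A (taylorRem 1 (fun r => evolDeriv B r f₀ (app A f₀)) τ) C
  /-- `‖d²/ds² (∂₂E_B(τ-s, f(t+s)) A u(s))‖ ≤ C` -/
  trapezoid_mem : ∀ s ∈ Icc 0 τ, u s ∈ A.domain
  trapezoid : SecondDerivLE (fun s => evolDeriv B (τ - s) (f (t + s)) (app A (u s))) 0 τ C
  /-- `k(s, σ) = ∂₂E_B(τ-s, f(t+s)) A ∂₂E_B(s-σ, f(t+σ)) A u(σ)` is defined for
  `0 ≤ σ ≤ s ≤ τ`, and both first partial derivatives are bounded by `C` -/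
  cubature_mem : ∀ s ∈ Icc 0 τ, ∀ σ ∈ Icc 0 s,
    u σ ∈ (A ⬝ₒ evolDerivOp B (s - σ) (f (t + σ)) ⬝ₒ A).domain
  cubature_fst : ∀ σ ∈ Icc 0 τ, DerivLE (fun s =>
    evolDeriv B (τ - s) (f (t + s)) (app (A ⬝ₒ evolDerivOp B (s - σ) (f (t + σ)) ⬝ₒ A) (u σ))) σ τ C
  cubature_snd : ∀ s ∈ Icc 0 τ, DerivLE (fun σ =>
    evolDeriv B (τ - s) (f (t + s)) (app (A ⬝ₒ evolDerivOp B (s - σ) (f (t + σ)) ⬝ₒ A) (u σ))) 0 s C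
  /-- `‖∏_{k=0}^{2} (∂₂E_B(σ_k-σ_{k+1}, f(t+σ_{k+1})) A) f(t+σ_3)‖ ≤ C` for
  `0 ≤ σ_3 ≤ σ_2 ≤ σ_1 ≤ σ_0 = τ` -/
  third_order_exact : ∀ σ₁ σ₂ σ₃, 0 ≤ σ₃ → σ₃ ≤ σ₂ → σ₂ ≤ σ₁ → σ₁ ≤ τ →
    NormLE (evolDerivOp B (τ - σ₁) (f (t + σ₁)) ⬝ₒ A ⬝ₒ evolDerivOp B (σ₁ - σ₂) (f (t + σ₂)) ⬝ₒ A ⬝ₒ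
      evolDerivOp B (σ₂ - σ₃) (f (t + σ₃)) ⬝ₒ A) (f (t + σ₃)) C
  /-- `‖{A, {A, {A, e^{(s/2)A} e^{τB̃} e^{(s/2)A}}}} f₀‖ ≤ C` -/
  third_order_splitting : ∀ s ∈ Icc 0 τ,
    NormLE (anticomm A (anticomm A (anticomm A
      (expOp' A (s / 2) ⬝ₒ expOp' Bt τ ⬝ₒ expOp' A (s / 2))))) f₀ C

/-- The operator bounds with constant `C` for one step of size `τ` that starts at time `t`, where
`f₀ = f(t)`, `B̃ = B(f(t + τ/2))` and `u(s) = E_B(s, f₀)`. -/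
def Estimates (A : X →ₗ.[ℝ] X) (B : X → X →ₗ.[ℝ] X) (f : ℝ → X) (t τ C : ℝ) : Prop :=
  StepEstimates A B f t τ C (f t) (B (f (t + τ / 2))) (fun s => evol B s (f t))

/-! ### Consistency -/

/-- The splitting operator `e^{(τ/2)A} e^{τB(w)} e^{(τ/2)A}` with frozen nonlinearity `B(w)`. -/
def strang (A : X →ₗ.[ℝ] X) (B : X → X →ₗ.[ℝ] X) (τ : ℝ) (w x : X) : X :=
  expOp A (τ / 2) (expOp (B w) τ (expOp A (τ / 2) x))

/-- Consistency of order `p` along `f`: with `t_k = k τ` and the exact midpoint value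
`f(t_k + τ/2)` in the nonlinearity, the local error is bounded by `C τ^{p+1}`, uniformly in all
steps that stay in `[0, T]`. -/
def ConsistentOfOrder (p : ℕ) (A : X →ₗ.[ℝ] X) (B : X → X →ₗ.[ℝ] X) (T : ℝ) (f : ℝ → X) : Prop :=
  ∃ C : ℝ, ∀ (τ : ℝ) (k : ℕ), 0 < τ → k * τ + τ ≤ T →
    ‖f (k * τ + τ) - strang A B τ (f (k * τ + τ / 2)) (f (k * τ))‖ ≤ C * τ ^ (p + 1)

end StrangSplitting

end

/-! Both sides of the estimate are expanded to second order in `A`, with the flow of the nonlinear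
part, respectively the frozen semigroup, kept exact. The two expansions are then compared term by
term. Write f₀ = f(t), u(s) = E_B(s, f₀), V = e^{τB̃}, and b = B'(A f₀) f₀.

Exact solution. The nonlinear variation of constants formula `RegularAlong.sub_evol_eq_integral`
writes f(t+τ) - u(τ) as an integral of ∂₂E_B applied to A f. Iterating it, with the trapezoidal rule
for the single integral, a Lipschitz kernel for the double one and a bounded triple product for the
rest, gives `norm_exact_step_le`: f(t+τ) = u(τ) + (τ/2)(∂₂E_B(τ,f₀)A f₀ + A u(τ)) + (τ²/2)
∂₂E_B(τ,f₀)A² f₀ + O(τ³).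

Splitting. The derivatives of σ ↦ e^{σA} V e^{σA} are iterated anticommutators with A, so Taylor
expansion up to σ = τ/2 gives `norm_strang_step_le`: V f₀ + (τ/2){A,V} f₀ + (τ²/8){A,{A,V}} f₀ +
O(τ³).

Comparison. The terms of order zero do not agree to third order. B̃ is frozen at f(t+τ/2), which
differs from u(τ/2) by about (τ/2)A f₀, so u(τ) - V f₀ = -(τ²/2) b + O(τ³)
(`StepEstimates.norm_sub_add_opDeriv_le`). On the other hand, the derivative of r ↦ ∂₂E_B(r,f₀)A f₀
at 0 is B(f₀)A f₀ + b, by symmetry of mixed derivatives, so (τ/2)(∂₂E_B(τ,f₀) - V)A f₀ = +(τ²/2) b +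
O(τ³) (`StepEstimates.norm_evolDeriv_sub_zero_le`). The two contributions cancel, and this is why
the midpoint value is the right one. In the quadratic terms A²V f₀, 2AVA f₀ and VA² f₀ all agree up
to O(τ) with multiples of ∂₂E_B(τ,f₀)A² f₀, and (1+2+1)/8 = 1/2.

Since A is unbounded and often only whole expressions are bounded, A is moved through integrals by
closedness, and derivatives are taken after smoothing with the averages h⁻¹∫₀^h e^{rA} dr, which are
uniformly bounded and tend strongly to the identity. -/

namespace StrangSplitting

variable {X : Type*} [NormedAddCommGroup X] [NormedSpace ℝ X]

/-! ### Calculus on the line -/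

theorem hasDerivWithinAt_Ioi_iff_tendsto {F : ℝ → X} {y : X} {s : ℝ} :
    HasDerivWithinAt F y (Ioi s) s ↔
      Tendsto (fun h : ℝ => h⁻¹ • (F (s + h) - F s)) (𝓝[>] 0) (𝓝 y) := by
  rw [hasDerivWithinAt_iff_tendsto_slope' (by simp)]
  have h1 : map (fun h : ℝ => s + h) (𝓝[>] 0) = 𝓝[>] s := by
    simp
  rw [← h1, tendsto_map'_iff]
  refine tendsto_congr fun h => ?_
  simp [slope_def_module]

/-- Semigroups and ∂₂E_B are only strongly continuous; a uniform bound is what allows the argument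
to vary together with the operator. -/
theorem tendsto_clm_apply_of_bounded {α : Type*} {l : Filter α} {L : α → X →L[ℝ] X} {g : α → X}
    {x y : X} {N : ℝ} (hN : ∀ᶠ a in l, ‖L a‖ ≤ N) (hL : Tendsto (fun a => L a x) l (𝓝 y))
    (hg : Tendsto g l (𝓝 x)) : Tendsto (fun a => L a (g a)) l (𝓝 y) := by
  have h0 : Tendsto (fun a => L a (g a - x)) l (𝓝 0) := by
    refine squeeze_zero_norm' (a := fun a => N * ‖g a - x‖) ?_ ?_
    · filter_upwards [hN] with a ha
      exact (L a).le_of_opNorm_le ha _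
    · simpa using (tendsto_iff_norm_sub_tendsto_zero.1 hg).const_mul N
  simpa using h0.add hL

theorem continuousOn_clm_apply_of_bounded {α : Type*} [TopologicalSpace α] {K : Set α}
    {L : α → X →L[ℝ] X} {g : α → X} {N : ℝ} (hN : ∀ a ∈ K, ‖L a‖ ≤ N)
    (hL : ∀ x, ContinuousOn (fun a => L a x) K) (hg : ContinuousOn g K) :
    ContinuousOn (fun a => L a (g a)) K := fun a ha =>
  tendsto_clm_apply_of_bounded (eventually_mem_nhdsWithin.mono hN) (hL (g a) a ha) (hg a ha)

theorem exists_norm_le_of_isCompact [CompleteSpace X] {α : Type*} [TopologicalSpace α] {K : Set α}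
    (hK : IsCompact K) {L : α → X →L[ℝ] X} (hL : ∀ x, ContinuousOn (fun a => L a x) K) :
    ∃ N, 0 ≤ N ∧ ∀ a ∈ K, ‖L a‖ ≤ N := by
  obtain ⟨N, hN⟩ := banach_steinhaus (g := fun a : K => L a) fun x => by
    obtain ⟨c, hc⟩ := hK.exists_bound_of_continuousOn (hL x)
    exact ⟨c, fun a => hc a a.2⟩
  exact ⟨max N 0, le_max_right _ _, fun a ha => (hN ⟨a, ha⟩).trans (le_max_left _ _)⟩

theorem norm_intervalIntegral_sub_le [CompleteSpace X] {g : ℝ → X} {a b K : ℝ} {c : X} (hab : a ≤ b)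
    (hg : IntervalIntegrable g MeasureTheory.volume a b)
    (h : ∀ s ∈ Ioc a b, ‖g s - c‖ ≤ K) :
    ‖(∫ s in a..b, g s) - (b - a) • c‖ ≤ K * (b - a) := by
  have h1 : (∫ s in a..b, g s) - (b - a) • c = ∫ s in a..b, (g s - c) := by
    rw [intervalIntegral.integral_sub hg (by simp), intervalIntegral.integral_const]
  rw [h1, ← abs_of_nonneg (sub_nonneg.2 hab)]
  refine intervalIntegral.norm_integral_le_of_norm_le_const fun s hs => h s ?_
  rwa [uIoc_of_le hab] at hs

/-- Second order Taylor estimate when the second derivative is bounded but need not be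
integrable. -/
theorem SecondDerivLE.exists_norm_sub_le {g : ℝ → X} {τ C : ℝ}
    (hτ : 0 ≤ τ) (hg : SecondDerivLE g 0 τ C) :
    ∃ b, ∀ s ∈ Icc 0 τ, ‖g s - g 0 - s • b‖ ≤ C * τ ^ 2 := by
  have h0 : (0 : ℝ) ∈ Icc 0 τ := ⟨le_rfl, hτ⟩
  have hC : 0 ≤ C := (norm_nonneg _).trans (hg.2.2 0 h0)
  refine ⟨derivWithin g (Icc 0 τ) 0, fun s hs => ?_⟩
  have h1 : ∀ x ∈ Icc 0 τ, ‖derivWithin g (Icc 0 τ) x - derivWithin g (Icc 0 τ) 0‖ ≤ C * τ := by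
    intro x hx
    refine ((convex_Icc 0 τ).norm_image_sub_le_of_norm_derivWithin_le hg.2.1 hg.2.2 h0 hx).trans ?_
    rw [sub_zero, Real.norm_of_nonneg hx.1]
    exact mul_le_mul_of_nonneg_left hx.2 hC
  have h2 := (convex_Icc 0 τ).norm_image_sub_le_of_norm_hasDerivWithin_le
    (f := fun x => g x - x • derivWithin g (Icc 0 τ) 0)
    (f' := fun x => derivWithin g (Icc 0 τ) x - derivWithin g (Icc 0 τ) 0) (C := C * τ)
    (fun x hx => by
      simpa using ((hg.1 x hx).hasDerivWithinAt).fun_sub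
        ((hasDerivWithinAt_id x _).smul_const (derivWithin g (Icc 0 τ) 0))) h1 h0 hs
  calc _ = ‖g s - s • derivWithin g (Icc 0 τ) 0 - (g 0 - (0 : ℝ) • derivWithin g (Icc 0 τ) 0)‖ := by
        congr 1; module
    _ ≤ C * τ * ‖s - 0‖ := h2
    _ ≤ C * τ ^ 2 := by
        rw [sub_zero, Real.norm_of_nonneg hs.1]
        nlinarith [hs.1, hs.2, mul_nonneg hC hτ, mul_le_mul_of_nonneg_left hs.2 (mul_nonneg hC hτ)]

theorem SecondDerivLE.continuousOn {g : ℝ → X} {a b C : ℝ} (hg : SecondDerivLE g a b C) :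
    ContinuousOn g (Icc a b) := hg.1.continuousOn

/-- Both quadrature rules below are exact for the affine function s ↦ g 0 + s b, so each follows by
evaluating the remainder at its own nodes. -/
theorem SecondDerivLE.norm_integral_sub_affine_le [CompleteSpace X] {g : ℝ → X} {τ C : ℝ} {b : X}
    (hτ : 0 ≤ τ) (hg : SecondDerivLE g 0 τ C)
    (hb : ∀ s ∈ Icc 0 τ, ‖g s - g 0 - s • b‖ ≤ C * τ ^ 2) :
    ‖(∫ s in (0 : ℝ)..τ, g s) - τ • g 0 - (τ ^ 2 / 2) • b‖ ≤ C * τ ^ 3 := by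
  have hgi : IntervalIntegrable g MeasureTheory.volume 0 τ :=
    ContinuousOn.intervalIntegrable (by rw [uIcc_of_le hτ]; exact hg.continuousOn)
  have hi : IntervalIntegrable (fun s : ℝ => s • b) MeasureTheory.volume 0 τ :=
    (continuous_id.smul continuous_const).intervalIntegrable _ _
  have h := norm_intervalIntegral_sub_le (g := fun s => g s - s • b) (c := g 0) (K := C * τ ^ 2) hτ
    (hgi.sub hi) fun s hs => by
      have := hb s ⟨hs.1.le, hs.2⟩
      rwa [sub_right_comm] at this
  rw [intervalIntegral.integral_sub hgi hi, intervalIntegral.integral_smul_const, integral_id] at h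
  refine le_of_eq_of_le ?_ (h.trans_eq (by ring))
  congr 1
  module

/-- The midpoint rule. -/
theorem SecondDerivLE.norm_integral_sub_midpoint_le [CompleteSpace X] {g : ℝ → X} {τ C : ℝ}
    (hτ : 0 ≤ τ) (hg : SecondDerivLE g 0 τ C) :
    ‖(∫ s in (0 : ℝ)..τ, g s) - τ • g (τ / 2)‖ ≤ 2 * C * τ ^ 3 := by
  obtain ⟨b, hb⟩ := hg.exists_norm_sub_le hτ
  have h1 := hg.norm_integral_sub_affine_le hτ hb
  have h2 := hb (τ / 2) ⟨by linarith, by linarith⟩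
  calc _ = ‖((∫ s in (0 : ℝ)..τ, g s) - τ • g 0 - (τ ^ 2 / 2) • b)
        - τ • (g (τ / 2) - g 0 - (τ / 2) • b)‖ := by congr 1; module
    _ ≤ C * τ ^ 3 + τ * (C * τ ^ 2) := by
        refine (norm_sub_le _ _).trans (add_le_add h1 ?_)
        rw [norm_smul, Real.norm_of_nonneg hτ]
        exact mul_le_mul_of_nonneg_left h2 hτ
    _ = _ := by ring

/-- The trapezoidal rule. -/
theorem SecondDerivLE.norm_integral_sub_trapezoid_le [CompleteSpace X] {g : ℝ → X} {τ C : ℝ}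
    (hτ : 0 ≤ τ) (hg : SecondDerivLE g 0 τ C) :
    ‖(∫ s in (0 : ℝ)..τ, g s) - (τ / 2) • (g 0 + g τ)‖ ≤ 2 * C * τ ^ 3 := by
  obtain ⟨b, hb⟩ := hg.exists_norm_sub_le hτ
  have h1 := hg.norm_integral_sub_affine_le hτ hb
  have h2 := hb τ ⟨hτ, le_rfl⟩
  have hC : 0 ≤ C * τ ^ 2 := (norm_nonneg _).trans h2
  calc _ = ‖((∫ s in (0 : ℝ)..τ, g s) - τ • g 0 - (τ ^ 2 / 2) • b)
        - (τ / 2) • (g τ - g 0 - τ • b)‖ := by congr 1; module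
    _ ≤ C * τ ^ 3 + τ / 2 * (C * τ ^ 2) := by
        refine (norm_sub_le _ _).trans (add_le_add h1 ?_)
        rw [norm_smul, Real.norm_of_nonneg (by linarith)]
        exact mul_le_mul_of_nonneg_left h2 (by linarith)
    _ ≤ _ := by nlinarith

theorem DerivLE.norm_sub_le {g : ℝ → X} {a b C x y : ℝ} (hg : DerivLE g a b C)
    (hx : x ∈ Icc a b) (hy : y ∈ Icc a b) : ‖g y - g x‖ ≤ C * |y - x| :=
  (convex_Icc a b).norm_image_sub_le_of_norm_derivWithin_le hg.1 hg.2 hx hy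

/-- Third order Taylor estimate with one-sided derivatives. -/
theorem norm_taylor_two_le {G₀ G₁ G₂ G₃ : ℝ → X} {τ K : ℝ} (hτ : 0 ≤ τ)
    (h₀ : ContinuousOn G₀ (Icc 0 τ)) (h₁ : ContinuousOn G₁ (Icc 0 τ))
    (h₂ : ContinuousOn G₂ (Icc 0 τ))
    (d₀ : ∀ s ∈ Ico 0 τ, HasDerivWithinAt G₀ (G₁ s) (Ici s) s)
    (d₁ : ∀ s ∈ Ico 0 τ, HasDerivWithinAt G₁ (G₂ s) (Ici s) s)
    (d₂ : ∀ s ∈ Ico 0 τ, HasDerivWithinAt G₂ (G₃ s) (Ici s) s)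
    (hK₀ : 0 ≤ K) (hK : ∀ s ∈ Ico 0 τ, ‖G₃ s‖ ≤ K) :
    ‖G₀ τ - G₀ 0 - τ • G₁ 0 - (τ ^ 2 / 2) • G₂ 0‖ ≤ K * τ ^ 3 := by
  have e₂ : ∀ s ∈ Icc 0 τ, ‖G₂ s - G₂ 0‖ ≤ K * τ := fun s hs =>
    (norm_image_sub_le_of_norm_deriv_right_le_segment h₂ d₂ hK s hs).trans
      (mul_le_mul_of_nonneg_left (by linarith [hs.2]) hK₀)
  have e₁ : ∀ s ∈ Icc 0 τ, ‖G₁ s - G₁ 0 - s • G₂ 0‖ ≤ K * τ * τ := fun s hs => by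
    have := norm_image_sub_le_of_norm_deriv_right_le_segment (f := fun s => G₁ s - s • G₂ 0)
      (f' := fun s => G₂ s - G₂ 0) (C := K * τ) (a := 0) (b := τ)
      (h₁.sub (by fun_prop)) (fun s hs => by
        simpa using (d₁ s hs).fun_sub ((hasDerivWithinAt_id s _).smul_const (G₂ 0)))
      (fun s hs => e₂ s ⟨hs.1, hs.2.le⟩) s hs
    refine le_trans (le_of_eq (by congr 1; module)) (this.trans
      (mul_le_mul_of_nonneg_left (by linarith [hs.2]) (by positivity)))
  have := norm_image_sub_le_of_norm_deriv_right_le_segment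
    (f := fun s => G₀ s - s • G₁ 0 - (s ^ 2 / 2) • G₂ 0)
    (f' := fun s => G₁ s - G₁ 0 - s • G₂ 0) (C := K * τ * τ) (a := 0) (b := τ)
    ((h₀.sub (by fun_prop)).sub (by fun_prop)) (fun s hs => by
      have hq : HasDerivWithinAt (fun s : ℝ => s ^ 2 / 2) s (Ici s) s := by
        simpa using (((hasDerivAt_id s).pow 2).div_const 2).hasDerivWithinAt
      simpa using ((d₀ s hs).fun_sub ((hasDerivWithinAt_id s _).smul_const (G₁ 0))).fun_sub
        (hq.smul_const (G₂ 0)))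
    (fun s hs => e₁ s ⟨hs.1, hs.2.le⟩) τ ⟨hτ, le_rfl⟩
  refine le_trans (le_of_eq ?_) (this.trans_eq (by ring))
  congr 1
  module

/-! ### Taylor remainders -/

theorem smul_taylorRem_one [CompleteSpace X] {g : ℝ → X} {τ : ℝ} (hτ : 0 < τ)
    (hg : ContDiffOn ℝ 1 g (Icc 0 τ)) : τ • taylorRem 1 g τ = g τ - g 0 := by
  have h := taylor_integral_remainder (x₀ := 0) (x := τ) (n := 0) (f := g)
    (by simpa [uIcc_of_le hτ.le] using hg)
  rw [uIcc_of_le hτ.le] at h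
  simp only [taylor_within_zero_eval, zero_add] at h
  rw [h]
  simp [taylorRem]

theorem smul_taylorRem_two [CompleteSpace X] {g : ℝ → X} {τ : ℝ} (hτ : 0 < τ)
    (hg : ContDiffOn ℝ 2 g (Icc 0 τ)) :
    τ ^ 2 • taylorRem 2 g τ = g τ - g 0 - τ • derivWithin g (Icc 0 τ) 0 := by
  have h := taylor_integral_remainder (x₀ := 0) (x := τ) (n := 1) (f := g)
    (by simpa [uIcc_of_le hτ.le] using hg)
  rw [uIcc_of_le hτ.le] at h
  have e : g τ - g 0 - τ • derivWithin g (Icc 0 τ) 0 =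
      g τ - taylorWithinEval g 1 (Icc 0 τ) 0 τ := by
    rw [taylorWithinEval_succ]
    simp [iteratedDerivWithin_one, sub_sub]
  rw [e, h]
  -- The substitution x = τ s turns the remainder over [0, τ] into the normalised one.
  have := intervalIntegral.smul_integral_comp_mul_left (a := 0) (b := 1)
    (fun x => ((τ - x) ^ 1 / (1 ! : ℝ)) • iteratedDerivWithin (1 + 1) g (Icc 0 τ) x) τ
  simp only [mul_zero, mul_one] at this
  rw [← this]
  simp only [taylorRem]
  norm_num
  rw [pow_two, mul_smul, ← intervalIntegral.integral_smul]
  congr 2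
  ext s
  rw [smul_smul]
  congr 1
  ring

/-! ### Partially defined operators -/

theorem app_of_mem {E : X →ₗ.[ℝ] X} {x : X} (h : x ∈ E.domain) : app E x = E ⟨x, h⟩ := by
  simp [app, h]

theorem app_add {E : X →ₗ.[ℝ] X} {x y : X} (hx : x ∈ E.domain) (hy : y ∈ E.domain) :
    app E (x + y) = app E x + app E y := by
  rw [app_of_mem hx, app_of_mem hy, app_of_mem (add_mem hx hy), ← E.map_add]
  rfl

theorem app_smul {E : X →ₗ.[ℝ] X} {x : X} (c : ℝ) (hx : x ∈ E.domain) :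
    app E (c • x) = c • app E x := by
  rw [app_of_mem hx, app_of_mem (E.domain.smul_mem c hx), ← E.map_smul]
  rfl

theorem app_sub {E : X →ₗ.[ℝ] X} {x y : X} (hx : x ∈ E.domain) (hy : y ∈ E.domain) :
    app E (x - y) = app E x - app E y := by
  rw [app_of_mem hx, app_of_mem hy, app_of_mem (sub_mem hx hy), ← E.map_sub]
  rfl

theorem mem_opMul_domain {E F : X →ₗ.[ℝ] X} {x : X} :
    x ∈ (E ⬝ₒ F).domain ↔ x ∈ F.domain ∧ app F x ∈ E.domain := by
  constructor
  · rintro ⟨y, hy, rfl⟩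
    exact ⟨y.2, (app_of_mem y.2).symm ▸ hy⟩
  · rintro ⟨h, h'⟩
    rw [app_of_mem h] at h'
    exact ⟨⟨x, h⟩, h', rfl⟩

theorem app_opMul {E F : X →ₗ.[ℝ] X} {x : X} (h : x ∈ (E ⬝ₒ F).domain) :
    app (E ⬝ₒ F) x = app E (app F x) := by
  obtain ⟨h1, h2⟩ := mem_opMul_domain.1 h
  rw [app_of_mem h, app_of_mem h2]
  simp only [app_of_mem h1]
  rfl

theorem mem_total_domain (L : X →ₗ[ℝ] X) (x : X) : x ∈ (total L).domain := Submodule.mem_top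

@[simp] theorem app_total (L : X →ₗ[ℝ] X) (x : X) : app (total L) x = L x := by
  rw [app_of_mem (mem_total_domain L x)]
  rfl

theorem mem_add_domain {E F : X →ₗ.[ℝ] X} {x : X} :
    x ∈ (E + F).domain ↔ x ∈ E.domain ∧ x ∈ F.domain := Iff.rfl

theorem app_add_op {E F : X →ₗ.[ℝ] X} {x : X} (h : x ∈ (E + F).domain) :
    app (E + F) x = app E x + app F x := by
  rw [app_of_mem h, app_of_mem h.1, app_of_mem h.2, LinearPMap.add_apply]

theorem app_sub_op {E F : X →ₗ.[ℝ] X} {x : X} (h : x ∈ (E - F).domain) :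
    app (E - F) x = app E x - app F x := by
  rw [app_of_mem h, app_of_mem h.1, app_of_mem h.2, LinearPMap.sub_apply]

/-! ### Semigroups -/

namespace C0Semigroup

variable {S : C0Semigroup X} {x y : X}

/-- The semigroup as a function of a real time; it is the identity at negative times. -/
def at' (S : C0Semigroup X) (t : ℝ) : X →L[ℝ] X := S.op t.toNNReal

theorem at'_of_nonpos (S : C0Semigroup X) {t : ℝ} (ht : t ≤ 0) :
    S.at' t = ContinuousLinearMap.id ℝ X := by
  rw [at', Real.toNNReal_of_nonpos ht, S.op_zero]

@[simp] theorem at'_zero (S : C0Semigroup X) : S.at' 0 = ContinuousLinearMap.id ℝ X :=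
  S.at'_of_nonpos le_rfl

theorem at'_add (S : C0Semigroup X) {s t : ℝ} (hs : 0 ≤ s) (ht : 0 ≤ t) (x : X) :
    S.at' (s + t) x = S.at' s (S.at' t x) := by
  rw [at', Real.toNNReal_add hs ht, S.op_add]
  rfl

theorem at'_comm (S : C0Semigroup X) {s t : ℝ} (hs : 0 ≤ s) (ht : 0 ≤ t) (x : X) :
    S.at' s (S.at' t x) = S.at' t (S.at' s x) := by
  rw [← S.at'_add hs ht, ← S.at'_add ht hs, add_comm]

theorem continuous_at' (S : C0Semigroup X) (x : X) : Continuous fun t => S.at' t x :=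
  (S.continuous_op x).comp continuous_real_toNNReal

theorem exists_norm_at'_le [CompleteSpace X] (S : C0Semigroup X) (b : ℝ) :
    ∃ M, 1 ≤ M ∧ ∀ t ≤ b, ‖S.at' t‖ ≤ M := by
  obtain ⟨N, -, hN⟩ := exists_norm_le_of_isCompact (K := Icc 0 b) isCompact_Icc
    (L := S.at') fun x => (S.continuous_at' x).continuousOn
  refine ⟨max N 1, le_max_right _ _, fun t ht => ?_⟩
  rcases le_total 0 t with h | h
  · exact (hN t ⟨h, ht⟩).trans (le_max_left _ _)
  · rw [S.at'_of_nonpos h]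
    exact ContinuousLinearMap.norm_id_le.trans (le_max_right _ _)

theorem hasGen_iff : S.HasGen x y ↔
    Tendsto (fun h : ℝ => h⁻¹ • (S.at' h x - x)) (𝓝[>] 0) (𝓝 y) := Iff.rfl

theorem HasGen.at' (h : S.HasGen x y) {t : ℝ} (ht : 0 ≤ t) :
    S.HasGen (S.at' t x) (S.at' t y) := by
  rw [hasGen_iff] at h ⊢
  refine (((S.at' t).continuous.tendsto y).comp h).congr' ?_
  filter_upwards [self_mem_nhdsWithin] with r hr
  simp [S.at'_comm (le_of_lt hr) ht]

theorem HasGen.neg (h : S.HasGen x y) : S.HasGen (-x) (-y) := by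
  simpa using h.smul (-1)

theorem HasGen.sub {x' y' : X} (h : S.HasGen x y) (h' : S.HasGen x' y') :
    S.HasGen (x - x') (y - y') := by
  simpa [sub_eq_add_neg] using h.add h'.neg

theorem HasGen.hasDerivWithinAt (h : S.HasGen x y) {t : ℝ} (ht : 0 ≤ t) :
    HasDerivWithinAt (fun s => S.at' s x) (S.at' t y) (Ioi t) t := by
  rw [hasDerivWithinAt_Ioi_iff_tendsto]
  refine (h.at' ht).congr' ?_
  filter_upwards [self_mem_nhdsWithin] with r hr
  have hr' : 0 ≤ r := le_of_lt hr
  rw [add_comm t r, S.at'_add hr' ht]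
  rfl

theorem HasGen.integral [CompleteSpace X] (h : S.HasGen x y) {t : ℝ} (ht : 0 ≤ t) :
    ∫ s in (0 : ℝ)..t, S.at' s y = S.at' t x - x := by
  have := intervalIntegral.integral_eq_sub_of_hasDeriv_right_of_le ht
    (S.continuous_at' x).continuousOn (fun s hs => h.hasDerivWithinAt hs.1.le)
    ((S.continuous_at' y).intervalIntegrable 0 t)
  simpa using this

/-- Applying S(r) shifts the interval of integration, and the difference telescopes to the integral
over [t, t + r] minus that over [0, r]. -/
theorem hasGen_integral_orbit [CompleteSpace X] (S : C0Semigroup X) (z : X) {t : ℝ} (ht : 0 ≤ t) :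
    S.HasGen (∫ s in (0 : ℝ)..t, S.at' s z) (S.at' t z - z) := by
  have hc := S.continuous_at' z
  have hd : ∀ r : ℝ, HasDerivAt (fun u => ∫ s in (0 : ℝ)..u, S.at' s z) (S.at' r z) r := fun r =>
    (hc.integral_hasStrictDerivAt 0 r).hasDerivAt
  have h1 := hasDerivWithinAt_Ioi_iff_tendsto.1 (hd t).hasDerivWithinAt
  have h2 := hasDerivWithinAt_Ioi_iff_tendsto.1 (hd 0).hasDerivWithinAt
  have h3 := h1.sub h2
  simp only [at'_zero, ContinuousLinearMap.id_apply] at h3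
  rw [hasGen_iff]
  refine h3.congr' ?_
  filter_upwards [self_mem_nhdsWithin] with r hr
  have hr' : 0 ≤ r := le_of_lt hr
  have h4 : S.at' r (∫ s in (0 : ℝ)..t, S.at' s z) = ∫ s in r..(t + r), S.at' s z := by
    rw [← ContinuousLinearMap.intervalIntegral_comp_comm _ (hc.intervalIntegrable _ _)]
    have : ∫ s in (0 : ℝ)..t, S.at' (s + r) z = ∫ s in (0 + r)..(t + r), S.at' s z :=
      intervalIntegral.integral_comp_add_right (fun s => S.at' s z) r
    rw [zero_add] at this
    rw [← this]
    refine intervalIntegral.integral_congr fun s hs => ?_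
    rw [uIcc_of_le ht] at hs
    rw [add_comm s r, S.at'_add hr' hs.1]
  have h5 : (∫ s in (0 : ℝ)..(t + r), S.at' s z) - ∫ s in (0 : ℝ)..r, S.at' s z =
      ∫ s in r..(t + r), S.at' s z :=
    intervalIntegral.integral_interval_sub_left (hc.intervalIntegrable _ _)
      (hc.intervalIntegrable _ _)
  rw [h4, ← h5]
  simp only [zero_add, intervalIntegral.integral_same, ← smul_sub]
  congr 1
  abel

/-- The difference quotient `(S(h) - 1) / h`. -/
noncomputable def quot (S : C0Semigroup X) (h : ℝ) : X →L[ℝ] X := h⁻¹ • (S.at' h - ContinuousLinearMap.id ℝ X)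

theorem quot_apply (S : C0Semigroup X) (h : ℝ) (x : X) :
    S.quot h x = h⁻¹ • (S.at' h x - x) := rfl

theorem hasGen_iff_tendsto_quot :
    S.HasGen x y ↔ Tendsto (fun h : ℝ => S.quot h x) (𝓝[>] 0) (𝓝 y) := Iff.rfl

theorem quot_at'_comm (S : C0Semigroup X) {h t : ℝ} (hh : 0 ≤ h) (ht : 0 ≤ t) (x : X) :
    S.quot h (S.at' t x) = S.at' t (S.quot h x) := by
  simp only [quot_apply, map_smul, map_sub, S.at'_comm hh ht]

open MeasureTheory in
-- Nothing is assumed about the measurability of k: it is a limit of the bounded operators `S.quot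
-- (1 / (n + 1))` applied to g.
theorem aestronglyMeasurable_of_hasGen {μ : Measure ℝ} {g k : ℝ → X}
    (hg : AEStronglyMeasurable g μ) (h : ∀ᵐ s ∂μ, S.HasGen (g s) (k s)) :
    AEStronglyMeasurable k μ := by
  have hn : Tendsto (fun n : ℕ => 1 / ((n : ℝ) + 1)) atTop (𝓝[>] (0 : ℝ)) :=
    tendsto_nhdsWithin_iff.2 ⟨tendsto_one_div_add_atTop_nhds_zero_nat,
      Eventually.of_forall fun n => by simp only [mem_Ioi]; positivity⟩
  refine aestronglyMeasurable_of_tendsto_ae atTop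
    (f := fun (n : ℕ) s => S.quot (1 / ((n : ℝ) + 1)) (g s))
    (fun n => (ContinuousLinearMap.continuous _).comp_aestronglyMeasurable hg) ?_
  filter_upwards [h] with s hs
  exact (hasGen_iff_tendsto_quot.1 hs).comp hn

/-- The mean `1/h ∫_0^h S(r) dr`. -/
noncomputable def avg [CompleteSpace X] (S : C0Semigroup X) (h : ℝ) : X →L[ℝ] X :=
  LinearMap.mkContinuousOfExistsBound
    { toFun := fun x => h⁻¹ • ∫ r in (0 : ℝ)..h, S.at' r x
      map_add' := fun x y => by
        simp only [map_add]
        rw [intervalIntegral.integral_add ((S.continuous_at' x).intervalIntegrable _ _)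
          ((S.continuous_at' y).intervalIntegrable _ _), smul_add]
      map_smul' := fun c x => by
        simp only [map_smul, RingHom.id_apply]
        rw [intervalIntegral.integral_smul, smul_comm] } <| by
    obtain ⟨M, -, hM⟩ := S.exists_norm_at'_le |h|
    refine ⟨|h⁻¹| * (M * |h|), fun x => ?_⟩
    simp only [LinearMap.coe_mk, AddHom.coe_mk, norm_smul, Real.norm_eq_abs]
    have := intervalIntegral.norm_integral_le_of_norm_le_const (a := 0) (b := h)
      (f := fun r => S.at' r x) (C := M * ‖x‖) fun r hr => by
        refine (S.at' r).le_of_opNorm_le (hM r ?_) x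
        have := uIoc_subset_uIcc hr
        have := abs_sub_left_of_mem_uIcc this
        simp only [sub_zero] at this
        exact (le_abs_self r).trans this
    rw [sub_zero] at this
    calc _ ≤ |h⁻¹| * (M * ‖x‖ * |h|) := mul_le_mul_of_nonneg_left this (abs_nonneg _)
      _ = _ := by ring

/-! ### Averages of the semigroup, closedness of the generator. -/

section avg

variable [CompleteSpace X]

theorem avg_apply (S : C0Semigroup X) (h : ℝ) (x : X) :
    S.avg h x = h⁻¹ • ∫ r in (0 : ℝ)..h, S.at' r x := rfl

/-- On the domain of the generator, averaging after the generator is the bounded operator `quot`.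
The closedness and smoothing arguments rest on this identity together with `tendsto_avg`. -/
theorem HasGen.avg_eq (hg : S.HasGen x y) {h : ℝ} (hh : 0 ≤ h) : S.avg h y = S.quot h x := by
  rw [avg_apply, hg.integral hh, quot_apply]

theorem hasGen_avg (S : C0Semigroup X) {h : ℝ} (hh : 0 ≤ h) (z : X) :
    S.HasGen (S.avg h z) (S.quot h z) :=
  (S.hasGen_integral_orbit z hh).smul _

theorem norm_avg_le {M h : ℝ} (hh : 0 < h) (hM : ∀ t ≤ h, ‖S.at' t‖ ≤ M) : ‖S.avg h‖ ≤ M := by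
  have hM0 : 0 ≤ M := (norm_nonneg _).trans (hM h le_rfl)
  refine ContinuousLinearMap.opNorm_le_bound _ hM0 fun x => ?_
  rw [avg_apply, norm_smul, Real.norm_of_nonneg (inv_nonneg.2 hh.le)]
  have := intervalIntegral.norm_integral_le_of_norm_le_const (a := 0) (b := h)
    (f := fun r => S.at' r x) (C := M * ‖x‖) fun r hr => by
      rw [uIoc_of_le hh.le] at hr
      exact (S.at' r).le_of_opNorm_le (hM r hr.2) x
  rw [sub_zero, abs_of_pos hh] at this
  calc _ ≤ h⁻¹ * (M * ‖x‖ * h) := mul_le_mul_of_nonneg_left this (by positivity)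
    _ = _ := by field_simp

theorem tendsto_avg (S : C0Semigroup X) (x : X) :
    Tendsto (fun h => S.avg h x) (𝓝[>] 0) (𝓝 x) := by
  have hd : HasDerivAt (fun u => ∫ s in (0 : ℝ)..u, S.at' s x) (S.at' 0 x) 0 :=
    ((S.continuous_at' x).integral_hasStrictDerivAt 0 0).hasDerivAt
  have h1 := hasDerivWithinAt_Ioi_iff_tendsto.1 hd.hasDerivWithinAt
  simpa [avg_apply] using h1

theorem avg_at'_comm (S : C0Semigroup X) {h t : ℝ} (hh : 0 ≤ h) (ht : 0 ≤ t) (x : X) :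
    S.avg h (S.at' t x) = S.at' t (S.avg h x) := by
  rw [avg_apply, avg_apply, map_smul,
    ← ContinuousLinearMap.intervalIntegral_comp_comm _ ((S.continuous_at' x).intervalIntegrable _ _)]
  congr 1
  refine intervalIntegral.integral_congr fun s hs => ?_
  rw [uIcc_of_le hh] at hs
  exact S.at'_comm hs.1 ht x

theorem avg_quot_comm (S : C0Semigroup X) {h : ℝ} (hh : 0 ≤ h) (x : X) :
    S.avg h (S.quot h x) = S.quot h (S.avg h x) := by
  simp only [quot_apply, map_smul, map_sub, S.avg_at'_comm hh hh]

open MeasureTheory in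
/-- A generator is closed, hence commutes with integrals of bounded functions. -/
theorem hasGen_integral {g k : ℝ → X} {a b C : ℝ} (hab : a ≤ b)
    (hg : IntervalIntegrable g volume a b) (h : ∀ s ∈ Ioc a b, S.HasGen (g s) (k s))
    (hC : ∀ s ∈ Ioc a b, ‖k s‖ ≤ C) :
    IntervalIntegrable k volume a b ∧ S.HasGen (∫ s in a..b, g s) (∫ s in a..b, k s) := by
  have hk : IntervalIntegrable k volume a b := by
    rw [intervalIntegrable_iff_integrableOn_Ioc_of_le hab] at hg ⊢
    refine IntegrableOn.of_bound (by simp) ?_ C ?_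
    · exact aestronglyMeasurable_of_hasGen hg.aestronglyMeasurable
        ((ae_restrict_iff' measurableSet_Ioc).2 (Eventually.of_forall h))
    · exact (ae_restrict_iff' measurableSet_Ioc).2 (Eventually.of_forall hC)
  -- The difference quotient of ∫ g equals the average of ∫ k, which converges to ∫ k.
  refine ⟨hk, hasGen_iff_tendsto_quot.2 ((S.tendsto_avg _).congr' ?_)⟩
  filter_upwards [self_mem_nhdsWithin] with r hr
  rw [← ContinuousLinearMap.intervalIntegral_comp_comm _ hk,
    ← ContinuousLinearMap.intervalIntegral_comp_comm _ hg]
  refine intervalIntegral.integral_congr_ae (Eventually.of_forall fun s hs => ?_)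
  rw [uIoc_of_le hab] at hs
  exact (h s hs).avg_eq (le_of_lt hr)

/-- Landau's inequality: bounds on `A x` intermediate between those on `x` and `A² x`. -/
theorem norm_hasGen_le {z : X} {M a b : ℝ} (hM : ∀ t ≤ 1, ‖S.at' t‖ ≤ M) (hxy : S.HasGen x y)
    (hyz : S.HasGen y z) (hx : ‖x‖ ≤ a) (hz : ‖z‖ ≤ b) : ‖y‖ ≤ (M + 1) * a + M * b := by
  have hM0 : 0 ≤ M := (norm_nonneg _).trans (hM 1 le_rfl)
  have h1 : ∀ s ∈ Ioc (0 : ℝ) 1, ‖S.at' s y - y‖ ≤ M * b := fun s hs => by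
    rw [← hyz.integral hs.1.le]
    have := intervalIntegral.norm_integral_le_of_norm_le_const (a := 0) (b := s)
      (f := fun r => S.at' r z) (C := M * b) fun r hr => by
        rw [uIoc_of_le hs.1.le] at hr
        exact (S.at' r).le_of_opNorm_le_of_le (hM r (hr.2.trans hs.2)) hz
    refine this.trans ?_
    rw [sub_zero, abs_of_pos hs.1]
    exact mul_le_of_le_one_right (mul_nonneg hM0 ((norm_nonneg _).trans hz)) hs.2
  -- The mean of S(s) y over [0, 1] is S(1) x - x, so y is this vector up to M b.
  have h2 := norm_intervalIntegral_sub_le zero_le_one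
    ((S.continuous_at' y).intervalIntegrable _ _) h1
  rw [hxy.integral zero_le_one, sub_zero, one_smul, mul_one] at h2
  have h3 : ‖S.at' 1 x - x‖ ≤ M * a + a :=
    (norm_sub_le _ _).trans (add_le_add ((S.at' 1).le_of_opNorm_le_of_le (hM 1 le_rfl) hx) hx)
  calc ‖y‖ = ‖(S.at' 1 x - x) - (S.at' 1 x - x - y)‖ := by congr 1; abel
    _ ≤ (M * a + a) + M * b := (norm_sub_le _ _).trans (add_le_add h3 h2)
    _ = _ := by ring

end avg

theorem hasGen_app (h : x ∈ S.generator.domain) : S.HasGen x (app S.generator x) := by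
  rw [app_of_mem h]
  exact h.choose_spec

theorem HasGen.mem (h : S.HasGen x y) : x ∈ S.generator.domain := ⟨y, h⟩

theorem HasGen.app_eq (h : S.HasGen x y) : app S.generator x = y :=
  (hasGen_app h.mem).unique h

end C0Semigroup

/-- The semigroup generated by an operator. -/
theorem Generates.exists_semigroup {E : X →ₗ.[ℝ] X} (h : Generates E) :
    ∃ S : C0Semigroup X, S.generator = E ∧ ∀ t, expOp E t = S.at' t :=
  ⟨h.choose, h.choose_spec, fun t => by simp [expOp, h, C0Semigroup.at']⟩

/-! ### The φ functions as integrals of orbits. -/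

section phi

variable {E : X →ₗ.[ℝ] X} {S : C0Semigroup X}

theorem smul_phi_one (hS : ∀ t, expOp E t = S.at' t) (τ : ℝ) (x : X) :
    τ • phi E τ 1 x = ∫ s in (0 : ℝ)..τ, S.at' s x := by
  have h1 : phi E τ 1 x = ∫ θ in (0 : ℝ)..1, expOp E ((1 - θ) * τ) x := by
    simp [phi]
  have h2 : ∫ θ in (0 : ℝ)..1, expOp E ((1 - θ) * τ) x = ∫ θ in (0 : ℝ)..1, S.at' (θ * τ) x := by
    have := intervalIntegral.integral_comp_sub_left (a := 0) (b := 1)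
      (fun θ : ℝ => S.at' (θ * τ) x) 1
    simp only [hS]
    simpa using this
  rw [h1, h2, intervalIntegral.smul_integral_comp_mul_right (fun s => S.at' s x)]
  simp

theorem hasGen_phi_one [CompleteSpace X] (hS : ∀ t, expOp E t = S.at' t) {τ : ℝ} (hτ : 0 ≤ τ) (x : X) :
    S.HasGen (τ • phi E τ 1 x) (S.at' τ x - x) := by
  rw [smul_phi_one hS]
  exact S.hasGen_integral_orbit x hτ

theorem sq_smul_phi_two (hS : ∀ t, expOp E t = S.at' t) {τ : ℝ} (x : X) :
    τ ^ 2 • phi E τ 2 x = ∫ s in (0 : ℝ)..τ, (τ - s) • S.at' s x := by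
  have h1 : phi E τ 2 x = ∫ θ in (0 : ℝ)..1, θ • expOp E ((1 - θ) * τ) x := by
    simp [phi]
  have h2 : ∫ θ in (0 : ℝ)..1, θ • expOp E ((1 - θ) * τ) x =
      ∫ θ in (0 : ℝ)..1, (1 - θ) • S.at' (θ * τ) x := by
    have := intervalIntegral.integral_comp_sub_left (a := 0) (b := 1)
      (fun θ : ℝ => (1 - θ) • S.at' (θ * τ) x) 1
    simp only [hS]
    simpa using this
  have h3 := intervalIntegral.smul_integral_comp_mul_right (a := 0) (b := 1)
    (fun s => (τ - s) • S.at' s x) τ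
  simp only [zero_mul, one_mul] at h3
  rw [h1, h2, ← h3, pow_two, mul_smul, ← intervalIntegral.integral_smul]
  congr 2
  ext θ
  rw [smul_smul]
  congr 1
  ring

/-- Closedness puts the generator under the integral, and integrating the derivative of s ↦ (τ - s)
S(s) x evaluates the result. A second application of the generator then yields the remainder S(τ) x
- x - τ y. -/
theorem hasGen_phi_two [CompleteSpace X] {y : X} (hS : ∀ t, expOp E t = S.at' t) {τ : ℝ} (hτ : 0 ≤ τ) {x : X}
    (hxy : S.HasGen x y) :
    S.HasGen (τ ^ 2 • phi E τ 2 x) ((∫ s in (0 : ℝ)..τ, S.at' s x) - τ • x) := by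
  have hi : Continuous fun s => (τ - s) • S.at' s x :=
    (continuous_const.sub continuous_id).smul (S.continuous_at' x)
  have hi' : Continuous fun s => (τ - s) • S.at' s y :=
    (continuous_const.sub continuous_id).smul (S.continuous_at' y)
  obtain ⟨C, hC⟩ := isCompact_Icc.exists_bound_of_continuousOn (hi'.continuousOn (s := Icc 0 τ))
  rw [sq_smul_phi_two hS]
  have h1 := (C0Semigroup.hasGen_integral hτ (hi.intervalIntegrable 0 τ)
    (fun s hs => (hxy.at' hs.1.le).smul (τ - s)) (fun s hs => hC s ⟨hs.1.le, hs.2⟩)).2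
  convert h1 using 1
  have h2 := intervalIntegral.integral_eq_sub_of_hasDeriv_right_of_le (a := 0) (b := τ)
    (f := fun s => (τ - s) • S.at' s x) (f' := fun s => (τ - s) • S.at' s y - S.at' s x) hτ
    hi.continuousOn (fun s hs => by
      have := ((((hasDerivAt_id s).const_sub τ).hasDerivWithinAt).fun_smul
        (hxy.hasDerivWithinAt hs.1.le))
      simpa [sub_eq_add_neg] using this)
    ((hi'.sub (S.continuous_at' x)).intervalIntegrable _ _)
  rw [intervalIntegral.integral_sub (hi'.intervalIntegrable _ _)
    ((S.continuous_at' x).intervalIntegrable _ _)] at h2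
  simp only [sub_self, zero_smul, sub_zero, C0Semigroup.at'_zero, ContinuousLinearMap.id_apply,
    zero_sub] at h2
  rw [sub_eq_iff_eq_add] at h2
  rw [h2]
  abel

end phi

/-! ### Evolution operators -/

section evolution

variable {G : X → X →ₗ.[ℝ] X} {r r' h : ℝ} {u v : ℝ → X} {u₀ : X}

theorem IsSolution.congr (hu : IsSolution G r u) (huv : EqOn v u (Icc 0 r)) :
    IsSolution G r v where
  mem_domain t ht := by rw [huv ht]; exact hu.mem_domain t ht
  hasDeriv t ht := by
    rw [huv ht]
    exact (hu.hasDeriv t ht).congr huv (huv ht)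
  continuous_deriv := hu.continuous_deriv.congr fun t ht => by simp only [huv ht]

theorem IsSolution.mono (hu : IsSolution G r u) (hr : r' ≤ r) : IsSolution G r' u where
  mem_domain t ht := hu.mem_domain t ⟨ht.1, ht.2.trans hr⟩
  hasDeriv t ht := (hu.hasDeriv t ⟨ht.1, ht.2.trans hr⟩).mono (Icc_subset_Icc_right hr)
  continuous_deriv := hu.continuous_deriv.mono (Icc_subset_Icc_right hr)

theorem IsSolution.continuousOn (hu : IsSolution G r u) : ContinuousOn u (Icc 0 r) :=
  fun t ht => (hu.hasDeriv t ht).continuousWithinAt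

theorem IsSolution.hasDerivWithinAt_Ioi (hu : IsSolution G r u) {t : ℝ} (ht : t ∈ Ico 0 r) :
    HasDerivWithinAt u (app (G (u t)) (u t)) (Ioi t) t :=
  (hu.hasDeriv t ⟨ht.1, ht.2.le⟩).mono_of_mem_nhdsWithin
    (mem_of_superset (Ioo_mem_nhdsGT ht.2) fun _ hx => ⟨ht.1.trans hx.1.le, hx.2.le⟩)

theorem IsSolution.integral [CompleteSpace X] (hu : IsSolution G r u) (hr : 0 ≤ r) :
    ∫ t in (0 : ℝ)..r, app (G (u t)) (u t) = u r - u 0 :=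
  intervalIntegral.integral_eq_sub_of_hasDeriv_right_of_le hr hu.continuousOn
    (fun _ ht => hu.hasDerivWithinAt_Ioi ⟨ht.1.le, ht.2⟩)
    (ContinuousOn.intervalIntegrable (by rw [uIcc_of_le hr]; exact hu.continuous_deriv))

theorem IsSolution.shift (hu : IsSolution G (h + r) u) (hh : 0 ≤ h) :
    IsSolution G r (fun s => u (h + s)) where
  mem_domain t ht := hu.mem_domain _ ⟨add_nonneg hh ht.1, by linarith [ht.2]⟩
  hasDeriv t ht := by
    have h1 := hu.hasDeriv (h + t) ⟨add_nonneg hh ht.1, by linarith [ht.2]⟩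
    have h2 := h1.scomp t ((hasDerivAt_id t).const_add h).hasDerivWithinAt
      (s := Icc 0 r) fun s hs => ⟨add_nonneg hh hs.1, by simpa using hs.2⟩
    simpa [Function.comp_def] using h2
  continuous_deriv := hu.continuous_deriv.comp (by fun_prop)
    fun s hs => ⟨add_nonneg hh hs.1, by simpa using hs.2⟩

/-- At the junction both one-sided derivatives are given by the equation, so continuity of the glued
function is the only matching condition. -/
theorem IsSolution.append (hu : IsSolution G h u) (hv : IsSolution G r v) (hh : 0 ≤ h)
    (hr : 0 ≤ r) (huv : v 0 = u h) :
    IsSolution G (h + r) (fun s => if s ≤ h then u s else v (s - h)) := by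
  set w : ℝ → X := fun s => if s ≤ h then u s else v (s - h) with hw
  have e1 : EqOn w u (Icc 0 h) := fun s hs => by simp [hw, hs.2]
  have e2 : EqOn w (fun s => v (s - h)) (Icc h (h + r)) := fun s hs => by
    rcases hs.1.eq_or_lt with rfl | h'
    · simp [hw, huv]
    · simp [hw, h'.not_ge]
  have hun : Icc 0 (h + r) = Icc 0 h ∪ Icc h (h + r) :=
    (Icc_union_Icc_eq_Icc hh (by linarith)).symm
  have hw1 : IsSolution G h w := hu.congr e1
  have hm : MapsTo (fun s => s - h) (Icc h (h + r)) (Icc 0 r) := fun s hs =>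
    ⟨by simpa using hs.1, by simp only; linarith [hs.2]⟩
  have d2 : ∀ t ∈ Icc h (h + r),
      HasDerivWithinAt w (app (G (w t)) (w t)) (Icc h (h + r)) t := fun t ht => by
    have h2 := (hv.hasDeriv (t - h) (hm ht)).scomp t
      ((hasDerivAt_id t).sub_const h).hasDerivWithinAt (s := Icc h (h + r)) hm
    rw [e2 ht]
    refine HasDerivWithinAt.congr ?_ e2 (e2 ht)
    simpa [Function.comp_def] using h2
  refine ⟨fun t ht => ?_, fun t ht => ?_, ?_⟩
  · rw [hun] at ht
    rcases ht with ht | ht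
    · exact hw1.mem_domain t ht
    · rw [e2 ht]
      exact hv.mem_domain _ (hm ht)
  · rcases lt_trichotomy t h with h' | h' | h'
    · refine (hw1.hasDeriv t ⟨ht.1, h'.le⟩).mono_of_mem_nhdsWithin ?_
      filter_upwards [self_mem_nhdsWithin, mem_nhdsWithin_of_mem_nhds (Iio_mem_nhds h')] with s hs hs'
      exact ⟨hs.1, le_of_lt hs'⟩
    · subst h'
      rw [hun]
      exact (hw1.hasDeriv t ⟨hh, le_rfl⟩).union (d2 t ⟨le_rfl, ht.2⟩)
    · refine (d2 t ⟨h'.le, ht.2⟩).mono_of_mem_nhdsWithin ?_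
      filter_upwards [self_mem_nhdsWithin, mem_nhdsWithin_of_mem_nhds (Ioi_mem_nhds h')] with s hs hs'
      exact ⟨le_of_lt hs', hs.2⟩
  · rw [hun]
    refine hw1.continuous_deriv.union_of_isClosed ?_ isClosed_Icc isClosed_Icc
    refine ((hv.continuous_deriv.comp (by fun_prop) hm)).congr fun t ht => ?_
    simp only [e2 ht, Function.comp]

theorem wellPosed_mono (hr : r' ≤ r) (h : u₀ ∈ wellPosed G r) :
    u₀ ∈ wellPosed G r' := by
  obtain ⟨⟨u, hu, h0⟩, huniq⟩ := h
  exact ⟨⟨u, hu.mono hr, h0⟩, fun s hs => huniq s ⟨hs.1, hs.2.trans hr⟩⟩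

/-- `evol` chooses a solution on [0, s] that may depend on s. Uniqueness on every shorter interval,
as required in `wellPosed`, identifies all these choices with one curve. -/
theorem evol_eq (h : u₀ ∈ wellPosed G r) (hu : IsSolution G r u) (hu0 : u 0 = u₀) {s : ℝ}
    (hs : s ∈ Icc 0 r) : evol G s u₀ = u s := by
  have hex : ∃ u, IsSolution G s u ∧ u 0 = u₀ := ⟨u, hu.mono hs.2, hu0⟩
  rw [evol, dif_pos hex]
  exact h.2 s hs _ _ hex.choose_spec.1 (hu.mono hs.2) hex.choose_spec.2 hu0 ⟨hs.1, le_rfl⟩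

theorem isSolution_evol (h : u₀ ∈ wellPosed G r) : IsSolution G r (fun s => evol G s u₀) := by
  obtain ⟨u, hu, h0⟩ := h.1
  exact hu.congr fun s hs => evol_eq h hu h0 hs

theorem evol_zero (h : u₀ ∈ wellPosed G r) (hr : 0 ≤ r) : evol G 0 u₀ = u₀ := by
  obtain ⟨u, hu, h0⟩ := h.1
  rw [evol_eq h hu h0 ⟨le_rfl, hr⟩, h0]

/-- Uniqueness is inherited by prolonging backwards: a competitor starting at `evol G h u₀` is glued
to the solution on [0, h], and uniqueness from u₀ applies. -/
theorem evol_mem_wellPosed (hh : 0 ≤ h) (hr : 0 ≤ r) (h0 : u₀ ∈ wellPosed G (h + r)) :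
    evol G h u₀ ∈ wellPosed G r := by
  have hsol := isSolution_evol h0
  refine ⟨⟨_, hsol.shift hh, by simp⟩, fun s hs u v hu hv hu0 hv0 => ?_⟩
  have key : ∀ u, IsSolution G s u → u 0 = evol G h u₀ → ∀ x ∈ Icc 0 s,
      u x = evol G (h + x) u₀ := fun u hu hu0 x hx => by
    have := evol_eq (wellPosed_mono (by linarith [hs.2]) h0)
      ((hsol.mono (by linarith)).append hu hh hs.1 hu0)
      (by simpa [hh] using evol_zero h0 (by linarith)) (s := h + x)
      ⟨by linarith [hx.1], by linarith [hx.2]⟩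
    rw [this]
    rcases hx.1.eq_or_lt with rfl | h'
    · simp [hu0]
    · simp [h']
  exact fun x hx => (key u hu hu0 x hx).trans (key v hv hv0 x hx).symm

theorem evol_evol (hh : 0 ≤ h) (hr : 0 ≤ r) (h0 : u₀ ∈ wellPosed G (h + r)) :
    evol G r (evol G h u₀) = evol G (h + r) u₀ :=
  evol_eq (evol_mem_wellPosed hh hr h0) ((isSolution_evol h0).shift hh) (by simp) ⟨hr, le_rfl⟩

end evolution

/-! ### Hadamard derivatives -/

section hadamard

variable {F : X → X} {L : X →L[ℝ] X} {D : Set X} {u g : X}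

theorem HasHadamardDerivWithinAt.tendsto (hF : HasHadamardDerivWithinAt F L D u) {α : Type*}
    {l : Filter α} [l.IsCountablyGenerated] {c : α → ℝ} {d : α → X} (hc : ∀ᶠ a in l, 0 < c a)
    (hc0 : Tendsto c l (𝓝 0)) (hd : Tendsto d l (𝓝 g)) (hm : ∀ᶠ a in l, u + c a • d a ∈ D) :
    Tendsto (fun a => (c a)⁻¹ • (F (u + c a • d a) - F u)) l (𝓝 (L g)) := by
  refine tendsto_of_seq_tendsto fun x hx => ?_
  obtain ⟨N, hN⟩ := eventually_atTop.1 ((hx.eventually hc).and (hx.eventually hm))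
  rw [← tendsto_add_atTop_iff_nat N]
  have hs : Tendsto (fun n => x (n + N)) atTop l := hx.comp (tendsto_add_atTop_nat N)
  exact hF g (fun n => c (x (n + N))) (fun n => d (x (n + N))) (fun n => (hN _ (by simp)).1)
    (hc0.comp hs) (hd.comp hs) fun n => (hN _ (by simp)).2

theorem HasHadamardDerivWithinAt.apply_eq_of_eqOn_id (hF : HasHadamardDerivWithinAt F L D u)
    (hid : ∀ x ∈ D, F x = x) (hu : u ∈ D) {α : Type*} {l : Filter α} [l.IsCountablyGenerated]
    [l.NeBot] {c : α → ℝ} {d : α → X} (hc : ∀ᶠ a in l, 0 < c a)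
    (hc0 : Tendsto c l (𝓝 0)) (hd : Tendsto d l (𝓝 g)) (hm : ∀ᶠ a in l, u + c a • d a ∈ D) :
    L g = g := by
  refine tendsto_nhds_unique (hF.tendsto hc hc0 hd hm) (hd.congr' ?_)
  filter_upwards [hc, hm] with a ha hma
  rw [hid _ hma, hid _ hu, add_sub_cancel_left, inv_smul_smul₀ ha.ne']

/-- The derivative of the identity fixes every tangent direction, and these span a dense subspace.
Applied to E_B(0, ·). -/
theorem HasHadamardDerivWithinAt.eq_id (hF : HasHadamardDerivWithinAt F L D u)
    (hid : ∀ x ∈ D, F x = x) (hu : u ∈ D) (hD : UniqueDiffWithinAt ℝ D u) :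
    L = ContinuousLinearMap.id ℝ X := by
  refine ContinuousLinearMap.ext_on hD.dense_tangentConeAt fun y hy => ?_
  obtain ⟨c, d, hc, hm, hcd⟩ := mem_tangentConeAt_iff_exists_seq_norm_tendsto_atTop.1 hy
  have hc0 : Tendsto (fun n => (c n)⁻¹) atTop (𝓝 0) :=
    tendsto_inv₀_cobounded.comp (tendsto_norm_atTop_iff_cobounded.1 hc)
  have hne : ∀ᶠ n in atTop, c n ≠ 0 := by
    filter_upwards [hc.eventually_gt_atTop 0] with n hn
    exact norm_pos_iff.1 hn
  simp only [ContinuousLinearMap.id_apply]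
  -- The tangent cone admits scalars of both signs, the Hadamard derivative only positive ones.
  -- Either infinitely many scalars are positive and the limit is taken along them, or eventually
  -- all are negative and -y takes the place of y.
  by_cases hpos : ∃ᶠ n in atTop, 0 < c n
  · have : (atTop ⊓ 𝓟 {n | 0 < c n}).NeBot := frequently_mem_iff_neBot.1 hpos
    have hle : atTop ⊓ 𝓟 {n | 0 < c n} ≤ atTop := inf_le_left
    refine hF.apply_eq_of_eqOn_id hid hu (c := fun n => (c n)⁻¹) (d := fun n => c n • d n)
      (l := atTop ⊓ 𝓟 {n | 0 < c n}) ?_ (hc0.mono_left hle) (hcd.mono_left hle) ?_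
    · filter_upwards [mem_inf_of_right (mem_principal_self _)] with n hn
      exact inv_pos.2 hn
    · filter_upwards [hle hm, hle hne] with n h1 h2
      rwa [inv_smul_smul₀ h2]
  · have hneg : ∀ᶠ n in atTop, c n < 0 := by
      filter_upwards [not_frequently.1 hpos, hne] with n h1 h2
      exact lt_of_le_of_ne (not_lt.1 h1) h2
    have := hF.apply_eq_of_eqOn_id hid hu (c := fun n => -(c n)⁻¹) (d := fun n => -(c n • d n))
      (l := atTop) (g := -y) (by
        filter_upwards [hneg] with n hn
        exact neg_pos.2 (inv_lt_zero.2 hn)) (by simpa using hc0.neg) hcd.neg (by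
        filter_upwards [hm, hne] with n h1 h2
        rwa [neg_smul_neg, inv_smul_smul₀ h2])
    simpa using this

theorem EvolDifferentiableAt.hasHadamardDeriv {G : X → X →ₗ.[ℝ] X} {r : ℝ}
    (h : EvolDifferentiableAt G r u) :
    HasHadamardDerivWithinAt (evol G r) (evolDeriv G r u) (wellPosed G r) u := by
  rw [evolDeriv, dif_pos h]
  exact h.choose_spec

end hadamard

/-! ### The evolution along the exact solution -/

theorem isCompact_timeTriangle (T : ℝ) :
    IsCompact {p : ℝ × ℝ | 0 ≤ p.1 ∧ 0 ≤ p.2 ∧ p.1 + p.2 ≤ T} := by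
  refine (isCompact_Icc.prod isCompact_Icc : IsCompact (Icc 0 T ×ˢ Icc 0 T)).of_isClosed_subset
    ?_ fun p hp => ?_
  · exact (isClosed_le continuous_const continuous_fst).inter
      ((isClosed_le continuous_const continuous_snd).inter
        (isClosed_le (continuous_fst.add continuous_snd) continuous_const))
  · exact ⟨⟨hp.1, by linarith [hp.2.1, hp.2.2]⟩, ⟨hp.2.1, by linarith [hp.1, hp.2.2]⟩⟩

section along

variable {A : X →ₗ.[ℝ] X} {B : X → X →ₗ.[ℝ] X} {T : ℝ} {f : ℝ → X}

theorem RegularAlong.evol_zero (hreg : RegularAlong A B T f) {s : ℝ} (hs : s ∈ Icc 0 T) :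
    evol B 0 (f s) = f s :=
  StrangSplitting.evol_zero (hreg.wellPosed 0 s le_rfl hs.1 (by simpa using hs.2)) le_rfl

theorem RegularAlong.evolDeriv_zero (hreg : RegularAlong A B T f) {s : ℝ} (hs : s ∈ Icc 0 T) :
    evolDeriv B 0 (f s) = ContinuousLinearMap.id ℝ X := by
  have hT : 0 + s ≤ T := by simpa using hs.2
  exact (hreg.differentiable 0 s le_rfl hs.1 hT).hasHadamardDeriv.eq_id
    (fun x hx => StrangSplitting.evol_zero hx le_rfl) (hreg.wellPosed 0 s le_rfl hs.1 hT)
    (hreg.uniqueDiff 0 s le_rfl hs.1 hT)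

theorem RegularAlong.exists_norm_evolDeriv_le [CompleteSpace X] (hreg : RegularAlong A B T f) :
    ∃ N, 0 ≤ N ∧ ∀ a b, 0 ≤ b → b ≤ a → a ≤ T → ‖evolDeriv B (a - b) (f b)‖ ≤ N := by
  obtain ⟨N, h0, hN⟩ := exists_norm_le_of_isCompact (isCompact_timeTriangle T)
    (L := fun p : ℝ × ℝ => evolDeriv B p.1 (f p.2)) hreg.continuous_deriv_snd
  exact ⟨N, h0, fun a b hb hab ha => hN (a - b, b) ⟨sub_nonneg.2 hab, hb, by simpa using ha⟩⟩

theorem RegularAlong.continuousOn_evolDeriv [CompleteSpace X] (hreg : RegularAlong A B T f)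
    {a : ℝ} (ha : a ≤ T) {g : ℝ → X} {S : Set ℝ} (hS : S ⊆ Icc 0 a) (hg : ContinuousOn g S) :
    ContinuousOn (fun b => evolDeriv B (a - b) (f b) (g b)) S := by
  obtain ⟨N, -, hN⟩ := hreg.exists_norm_evolDeriv_le
  refine continuousOn_clm_apply_of_bounded (N := N)
    (fun b hb => hN a b (hS hb).1 (hS hb).2 ha) (fun x => ?_) hg
  exact (hreg.continuous_deriv_snd x).comp (f := fun b => (a - b, b)) (by fun_prop)
    fun b hb => ⟨sub_nonneg.2 (hS hb).2, (hS hb).1, by simpa using ha⟩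

theorem IsSolution.mem_add_domain (hf : IsSolution (fun v => A + B v) T f) {s : ℝ}
    (hs : s ∈ Icc 0 T) : f s ∈ A.domain ∧ f s ∈ (B (f s)).domain := hf.mem_domain s hs

theorem RegularAlong.continuousOn_nonlinear (hreg : RegularAlong A B T f) :
    ContinuousOn (fun s => app (B (f s)) (f s)) (Icc 0 T) := by
  have := hreg.continuous_deriv_fst.comp (f := fun s : ℝ => ((0 : ℝ), s)) (s := Icc 0 T)
    (by fun_prop) fun s hs => ⟨le_rfl, hs.1, by simpa using hs.2⟩
  refine this.congr fun s hs => ?_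
  simp only [Function.comp, hreg.evol_zero hs]

/-- A f is f' minus B(f) f, and the latter is ∂₁E_B(0, f(s)). -/
theorem RegularAlong.continuousOn_linear (hreg : RegularAlong A B T f)
    (hf : IsSolution (fun v => A + B v) T f) :
    ContinuousOn (fun s => app A (f s)) (Icc 0 T) := by
  refine (hf.continuous_deriv.sub hreg.continuousOn_nonlinear).congr fun s hs => ?_
  simp only [app_add_op (hf.mem_domain s hs), Pi.sub_apply, add_sub_cancel_right]

/-- The mean over `[0, r]` of the time derivative of the evolution starting at `f s`. -/
noncomputable def meanVelocity (B : X → X →ₗ.[ℝ] X) (f : ℝ → X) (p : ℝ × ℝ) : X :=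
  ∫ θ in (0 : ℝ)..1, app (B (evol B (p.1 * θ) (f p.2))) (evol B (p.1 * θ) (f p.2))

/-- With the factor r split off, joint continuity of `meanVelocity` up to r = 0 controls difference
quotients in r while the starting time moves too. -/
theorem RegularAlong.evol_eq_add [CompleteSpace X] (hreg : RegularAlong A B T f) {r s : ℝ}
    (hr : 0 ≤ r) (hs : 0 ≤ s) (hrs : r + s ≤ T) :
    evol B r (f s) = f s + r • meanVelocity B f (r, s) := by
  have h1 := (isSolution_evol (hreg.wellPosed r s hr hs hrs)).integral hr
  have h2 := intervalIntegral.smul_integral_comp_mul_left (a := 0) (b := 1)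
    (fun ρ => app (B (evol B ρ (f s))) (evol B ρ (f s))) r
  rw [mul_zero, mul_one, h1, hreg.evol_zero ⟨hs, by linarith⟩] at h2
  rw [meanVelocity, h2]
  abel

open MeasureTheory in
theorem RegularAlong.continuousOn_meanVelocity (hreg : RegularAlong A B T f) :
    ContinuousOn (meanVelocity B f) {p | 0 ≤ p.1 ∧ 0 ≤ p.2 ∧ p.1 + p.2 ≤ T} := by
  intro p hp
  obtain ⟨C, hC⟩ := (isCompact_timeTriangle T).exists_bound_of_continuousOn
    hreg.continuous_deriv_fst
  have hm : ∀ q : ℝ × ℝ, (0 ≤ q.1 ∧ 0 ≤ q.2 ∧ q.1 + q.2 ≤ T) → ∀ θ ∈ Icc (0 : ℝ) 1,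
      (q.1 * θ, q.2) ∈ {p : ℝ × ℝ | 0 ≤ p.1 ∧ 0 ≤ p.2 ∧ p.1 + p.2 ≤ T} := fun q hq θ hθ =>
    ⟨mul_nonneg hq.1 hθ.1, hq.2.1, by
      have := mul_le_of_le_one_right hq.1 hθ.2
      simp only
      linarith [hq.2.2]⟩
  refine intervalIntegral.continuousWithinAt_of_dominated_interval (bound := fun _ => C) ?_ ?_
    (by simp) (Eventually.of_forall fun θ hθ => ?_)
  · filter_upwards [self_mem_nhdsWithin] with q hq
    have : ContinuousOn (fun θ : ℝ => app (B (evol B (q.1 * θ) (f q.2))) (evol B (q.1 * θ) (f q.2)))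
        (Icc 0 1) :=
      hreg.continuous_deriv_fst.comp (f := fun θ : ℝ => (q.1 * θ, q.2)) (by fun_prop) (hm q hq)
    rw [uIoc_of_le zero_le_one]
    exact (this.mono Ioc_subset_Icc_self).aestronglyMeasurable measurableSet_Ioc
  · filter_upwards [self_mem_nhdsWithin] with q hq
    refine Eventually.of_forall fun θ hθ => ?_
    rw [uIoc_of_le zero_le_one] at hθ
    exact hC _ (hm q hq θ (Ioc_subset_Icc_self hθ))
  · rw [uIoc_of_le zero_le_one] at hθ
    exact (hreg.continuous_deriv_fst.comp (f := fun q : ℝ × ℝ => (q.1 * θ, q.2)) (by fun_prop)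
      fun q hq => hm q hq θ (Ioc_subset_Icc_self hθ)) p hp

theorem RegularAlong.continuousOn_evol [CompleteSpace X] (hreg : RegularAlong A B T f)
    (hf : IsSolution (fun v => A + B v) T f) :
    ContinuousOn (fun p : ℝ × ℝ => evol B p.1 (f p.2)) {p | 0 ≤ p.1 ∧ 0 ≤ p.2 ∧ p.1 + p.2 ≤ T} := by
  have h1 : ContinuousOn (fun p : ℝ × ℝ => f p.2 + p.1 • meanVelocity B f p)
      {p | 0 ≤ p.1 ∧ 0 ≤ p.2 ∧ p.1 + p.2 ≤ T} :=
    (hf.continuousOn.comp continuousOn_snd fun p hp => ⟨hp.2.1, by linarith [hp.1, hp.2.2]⟩).add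
      (continuousOn_fst.smul hreg.continuousOn_meanVelocity)
  exact h1.congr fun p hp => hreg.evol_eq_add hp.1 hp.2.1 hp.2.2

/-- Going back along the full flow and forward along the flow of B cancels B to first order and
leaves -A. -/
theorem RegularAlong.tendsto_evol_sub [CompleteSpace X] (hreg : RegularAlong A B T f)
    (hf : IsSolution (fun v => A + B v) T f) {b : ℝ} (hb : b ∈ Ioc 0 T) :
    Tendsto (fun h : ℝ => h⁻¹ • (evol B h (f (b - h)) - f b)) (𝓝[>] 0)
      (𝓝 (-(app A (f b)))) := by
  have hbT : b ∈ Icc 0 T := Ioc_subset_Icc_self hb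
  have hmem : ∀ᶠ h : ℝ in 𝓝[>] 0, h ∈ Ioo 0 b := Ioo_mem_nhdsGT hb.1
  have h1 : Tendsto (fun h : ℝ => meanVelocity B f (h, b - h)) (𝓝[>] 0)
      (𝓝 (app (B (f b)) (f b))) := by
    have e : meanVelocity B f (0, b) = app (B (f b)) (f b) := by
      simp [meanVelocity, hreg.evol_zero hbT]
    rw [← e]
    have hc := hreg.continuousOn_meanVelocity (0, b) ⟨le_rfl, hb.1.le, by simpa using hb.2⟩
    refine hc.tendsto.comp (tendsto_nhdsWithin_iff.2 ⟨?_, ?_⟩)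
    · have : Continuous fun h : ℝ => (h, b - h) := by fun_prop
      simpa using (this.tendsto 0).mono_left (nhdsWithin_le_nhds (s := Ioi 0))
    · filter_upwards [hmem] with h hh
      exact ⟨hh.1.le, by linarith [hh.2], by simpa using hb.2⟩
  have h2 : Tendsto (fun h : ℝ => h⁻¹ • (f (b - h) - f b)) (𝓝[>] 0)
      (𝓝 (-(app (A + B (f b)) (f b)))) := by
    have hd : HasDerivWithinAt f (app (A + B (f b)) (f b)) (Icc 0 T) (b - 0) := by
      simpa using hf.hasDeriv b hbT
    have h3 := (hd.scomp (0 : ℝ)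
      ((hasDerivAt_id (0 : ℝ)).const_sub b).hasDerivWithinAt (s := Ioo 0 b)
      fun h hh => ⟨by simpa using hh.2.le, by linarith [hh.1, hb.2]⟩)
    have h4 := hasDerivWithinAt_Ioi_iff_tendsto.1
      (h3.mono_of_mem_nhdsWithin (Ioo_mem_nhdsGT hb.1))
    simpa using h4
  have h3 := h1.add h2
  rw [app_add_op (hf.mem_domain b hbT), neg_add_rev, add_neg_cancel_left] at h3
  refine h3.congr' ?_
  filter_upwards [hmem] with h hh
  rw [hreg.evol_eq_add hh.1.le (by linarith [hh.2]) (by simpa using hb.2), add_sub_right_comm,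
    smul_add, inv_smul_smul₀ hh.1.ne', add_comm]

/-- The nonlinear variation of constants formula (Gröbner–Alekseev). -/
theorem RegularAlong.sub_evol_eq_integral [CompleteSpace X] (hreg : RegularAlong A B T f)
    (hf : IsSolution (fun v => A + B v) T f) {t a : ℝ} (ht : 0 ≤ t) (hta : t ≤ a) (ha : a ≤ T) :
    f a - evol B (a - t) (f t) =
      ∫ s in t..a, evolDeriv B (a - s) (f s) (app A (f s)) := by
  have hcont : ContinuousOn (fun r => evol B r (f (a - r))) (Icc 0 (a - t)) :=
    (hreg.continuousOn_evol hf).comp (f := fun r : ℝ => (r, a - r)) (by fun_prop)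
      fun r hr => ⟨hr.1, by simp only; linarith [hr.2], by simpa using ha⟩
  have hcd : ContinuousOn (fun s => evolDeriv B (a - s) (f s) (app A (f s))) (Icc t a) :=
    hreg.continuousOn_evolDeriv ha (Icc_subset_Icc_left ht)
      ((hreg.continuousOn_linear hf).mono (Icc_subset_Icc ht ha))
  have hcd' : ContinuousOn (fun r => -evolDeriv B (a - (a - r)) (f (a - r)) (app A (f (a - r))))
      (Icc 0 (a - t)) :=
    (hcd.comp (f := fun r => a - r) (by fun_prop)
      fun r hr => ⟨by linarith [hr.2], by linarith [hr.1]⟩).neg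
  have h := intervalIntegral.integral_eq_sub_of_hasDeriv_right_of_le (sub_nonneg.2 hta) hcont
    (f' := fun r => -evolDeriv B (a - (a - r)) (f (a - r)) (app A (f (a - r)))) (fun r hr => ?_)
    (ContinuousOn.intervalIntegrable (by rwa [uIcc_of_le (sub_nonneg.2 hta)]))
  · rw [intervalIntegral.integral_neg, intervalIntegral.integral_comp_sub_left
      (fun s => evolDeriv B (a - s) (f s) (app A (f s))) a] at h
    simp only [sub_sub_cancel, sub_zero] at h
    rw [hreg.evol_zero ⟨ht.trans hta, ha⟩, neg_eq_iff_eq_neg] at h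
    rw [h]
    abel
  · have hb : a - r ∈ Ioc 0 T := ⟨by linarith [hr.2], by linarith [hr.1]⟩
    have hrT : r + (a - r) ≤ T := by simpa using ha
    rw [hasDerivWithinAt_Ioi_iff_tendsto, sub_sub_cancel, ← map_neg]
    have hw : ∀ᶠ h : ℝ in 𝓝[>] 0, 0 < h ∧ f (a - r - h) ∈ StrangSplitting.wellPosed B (h + r) := by
      filter_upwards [Ioo_mem_nhdsGT hb.1] with h hh
      exact ⟨hh.1, hreg.wellPosed _ _ (by linarith [hh.1, hr.1]) (by linarith [hh.2])
        (by linarith)⟩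
    have e : ∀ h : ℝ, 0 < h →
        f (a - r) + h • (h⁻¹ • (evol B h (f (a - r - h)) - f (a - r))) =
          evol B h (f (a - r - h)) := fun h hh => by
      rw [smul_inv_smul₀ hh.ne', add_sub_cancel]
    -- By the flow property, E_B(r + h, f(a-r-h)) = E_B(r, E_B(h, f(a-r-h))). The inner value is
    -- f(a-r) plus h times a direction tending to -A f(a-r). Hadamard differentiability fits
    -- exactly: the direction varies with h, and the perturbed points are known to lie in the
    -- domain.
    have := (hreg.differentiable r (a - r) hr.1.le hb.1.le hrT).hasHadamardDeriv.tendsto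
      (l := 𝓝[>] (0 : ℝ)) (c := fun h => h)
      (d := fun h => h⁻¹ • (evol B h (f (a - r - h)) - f (a - r)))
      self_mem_nhdsWithin (tendsto_id.mono_left nhdsWithin_le_nhds)
      (hreg.tendsto_evol_sub hf hb) (by
        filter_upwards [hw] with h hh
        rw [e h hh.1]
        exact evol_mem_wellPosed hh.1.le hr.1.le hh.2)
    refine this.congr' ?_
    filter_upwards [hw] with h hh
    rw [e h hh.1, evol_evol hh.1.le hr.1.le hh.2, add_comm h r, sub_sub]

theorem hasDerivAt_evol_line {r ε : ℝ} {x g : X} {h : ℝ}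
    (hw : ∀ h ∈ Ioo (-ε) ε, x + h • g ∈ wellPosed B r)
    (hd : EvolDifferentiableAt B r (x + h • g)) (hh : h ∈ Ioo (-ε) ε) :
    HasDerivAt (fun h => evol B r (x + h • g)) (evolDeriv B r (x + h • g) g) h := by
  rw [hasDerivAt_iff_tendsto_slope_zero, ← Iio_union_Ioi, nhdsWithin_union, tendsto_sup]
  have hline : ∀ c : ℝ, x + (h + c) • g = x + h • g + c • g := fun c => by module
  have hev : ∀ᶠ c : ℝ in 𝓝 0, x + h • g + c • g ∈ wellPosed B r := by
    have : Tendsto (fun c => h + c) (𝓝 0) (𝓝 h) := by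
      simpa using (continuous_const_add h).tendsto 0
    filter_upwards [this (Ioo_mem_nhds hh.1 hh.2)] with c hc
    rw [← hline]
    exact hw _ hc
  simp only [hline]
  constructor
  · have hneg : Tendsto (fun c : ℝ => -c) (𝓝[<] 0) (𝓝 0) := by
      simpa using (continuous_neg.tendsto (0 : ℝ)).mono_left nhdsWithin_le_nhds
    have := hd.hasHadamardDeriv.tendsto (l := 𝓝[<] (0 : ℝ)) (c := fun c => -c) (d := fun _ => -g)
      (by filter_upwards [self_mem_nhdsWithin] with c hc using neg_pos.2 hc) hneg
      tendsto_const_nhds (by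
        filter_upwards [nhdsWithin_le_nhds hev] with c hc
        rwa [neg_smul_neg])
    simpa [inv_neg] using this.neg
  · exact hd.hasHadamardDeriv.tendsto (l := 𝓝[>] (0 : ℝ)) (c := fun c => c) (d := fun _ => g)
      self_mem_nhdsWithin (tendsto_id.mono_left nhdsWithin_le_nhds)
      tendsto_const_nhds (nhdsWithin_le_nhds hev)

/-- Off the solution curve no density of tangent directions is assumed, but in the direction g the
line itself determines the derivative. -/
theorem evolDeriv_zero_apply_line {ε : ℝ} {x g : X} {h : ℝ}
    (hw : ∀ h ∈ Ioo (-ε) ε, x + h • g ∈ wellPosed B 0)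
    (hd : EvolDifferentiableAt B 0 (x + h • g)) (hh : h ∈ Ioo (-ε) ε) :
    evolDeriv B 0 (x + h • g) g = g := by
  have h1 := hasDerivAt_evol_line hw hd hh
  have h2 : HasDerivAt (fun h : ℝ => x + h • g) g h := by
    simpa using ((hasDerivAt_id h).smul_const g).const_add x
  refine h1.unique (h2.congr_of_eventuallyEq ?_)
  filter_upwards [Ioo_mem_nhds hh.1 hh.2] with c hc
  exact evol_zero (hw c hc) le_rfl

/-- Symmetry of the mixed second derivative of the evolution operator at time `0`. -/
theorem RegularAlong.hasDerivWithinAt_evolDeriv (hreg : RegularAlong A B T f) {t : ℝ}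
    (ht : 0 ≤ t) (htT : t < T) :
    HasDerivWithinAt (fun r => evolDeriv B r (f t) (app A (f t)))
      (app (B (f t)) (app A (f t)) + opDeriv B (f t) (app A (f t)) (f t)) (Ici 0) 0 := by
  obtain ⟨ε, hε, m, hm, hmc⟩ := hreg.mixed_deriv t ht htT
  set g := app A (f t) with hg
  have h00 : (0 : ℝ) ∈ Ioo (-ε) ε := ⟨by linarith, hε⟩
  -- Schwarz's theorem by second differences: the bound on m is integrated in r (`e1`), then in h
  -- (`e2`), and division by r → 0 (`e3`) turns evolutions into B(v) v. Only m, not the second mixed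
  -- derivative in the other order, is assumed to exist.
  have hmain : HasDerivAt (fun h : ℝ => app (B (f t + h • g)) (f t + h • g)) (m (0, 0)) 0 := by
    rw [hasDerivAt_iff_isLittleO, Asymptotics.isLittleO_iff]
    intro δ hδ
    obtain ⟨ρ, hρ, hρm⟩ : ∃ ρ > 0, ρ < ε ∧ ∀ r ∈ Icc 0 ρ, ∀ h ∈ Icc (-ρ) ρ,
        ‖m (r, h) - m (0, 0)‖ ≤ δ := by
      have h1 := (Metric.continuousWithinAt_iff.1 (hmc (0, 0) ⟨⟨le_rfl, hε.le⟩, h00⟩)) δ hδ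
      obtain ⟨ρ, hρ, h2⟩ := h1
      refine ⟨min (ρ / 2) (ε / 2), by positivity, by
        linarith [min_le_right (ρ / 2) (ε / 2)], fun r hr h hh => ?_⟩
      have hr2 : r ≤ ρ / 2 := hr.2.trans (min_le_left _ _)
      have hr3 : r ≤ ε / 2 := hr.2.trans (min_le_right _ _)
      have hh2 : |h| ≤ ρ / 2 := (abs_le.2 hh).trans (min_le_left _ _)
      have hh3 : |h| ≤ ε / 2 := (abs_le.2 hh).trans (min_le_right _ _)
      rw [← dist_eq_norm]
      refine (h2 ⟨⟨hr.1, by linarith⟩, abs_lt.1 (by linarith)⟩ ?_).le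
      rw [Prod.dist_eq, max_lt_iff]
      simp only [Real.dist_eq, sub_zero, abs_of_nonneg hr.1]
      constructor <;> linarith
    obtain ⟨hρε, hρm⟩ := hρm
    have hsub : Icc (-ρ) ρ ⊆ Ioo (-ε) ε := fun h hh => ⟨by linarith [hh.1], by linarith [hh.2]⟩
    have hwr : ∀ r, r ≤ ε → ∀ h ∈ Ioo (-ε) ε, f t + h • g ∈ StrangSplitting.wellPosed B r :=
      fun r hr h hh => wellPosed_mono hr (hm h hh).1
    have e1 : ∀ r ∈ Icc 0 ρ, ∀ h ∈ Icc (-ρ) ρ,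
        ‖evolDeriv B r (f t + h • g) g - g - r • m (0, 0)‖ ≤ δ * r := fun r hr h hh => by
      have := (convex_Icc 0 ρ).norm_image_sub_le_of_norm_hasDerivWithin_le
        (f := fun r => evolDeriv B r (f t + h • g) g - r • m (0, 0))
        (f' := fun r => m (r, h) - m (0, 0)) (C := δ)
        (fun r hr => by
          have h1 := ((hm h (hsub hh)).2 r ⟨hr.1, by linarith [hr.2]⟩).2.mono
            (Icc_subset_Icc_right hρε.le)
          simpa using h1.fun_sub ((hasDerivWithinAt_id r _).smul_const (m (0, 0))))
        (fun r hr => hρm r hr h hh) ⟨le_rfl, hρ.le⟩ hr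
      rw [evolDeriv_zero_apply_line (hwr 0 hε.le) ((hm h (hsub hh)).2 0 ⟨le_rfl, hε.le⟩).1
        (hsub hh), zero_smul, sub_zero, sub_zero, Real.norm_of_nonneg hr.1, sub_right_comm] at this
      exact this
    have e2 : ∀ r ∈ Icc 0 ρ, ∀ h ∈ Icc (-ρ) ρ,
        ‖evol B r (f t + h • g) - evol B r (f t) - h • g - (h * r) • m (0, 0)‖ ≤ δ * r * |h| :=
      fun r hr h hh => by
      have := (convex_Icc (-ρ) ρ).norm_image_sub_le_of_norm_hasDerivWithin_le
        (f := fun h => evol B r (f t + h • g) - h • g - (h * r) • m (0, 0))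
        (f' := fun h => evolDeriv B r (f t + h • g) g - g - r • m (0, 0)) (C := δ * r) (x := 0)
        (fun h hh => by
          have h1 := (hasDerivAt_evol_line (hwr r (hr.2.trans hρε.le))
            ((hm h (hsub hh)).2 r ⟨hr.1, hr.2.trans hρε.le⟩).1 (hsub hh)).hasDerivWithinAt
              (s := Icc (-ρ) ρ)
          have h2 := (h1.fun_sub ((hasDerivWithinAt_id h _).smul_const g)).fun_sub
            (((hasDerivWithinAt_id h _).mul_const r).smul_const (m (0, 0)))
          simpa using h2)
        (fun h hh => e1 r hr h hh) ⟨by linarith, hρ.le⟩ hh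
      simp only [zero_smul, zero_mul, add_zero, sub_zero, Real.norm_eq_abs] at this
      refine le_trans (le_of_eq ?_) this
      congr 1
      abel
    have e3 : ∀ h ∈ Icc (-ρ) ρ,
        ‖app (B (f t + h • g)) (f t + h • g) - app (B (f t)) (f t) - h • m (0, 0)‖ ≤ δ * |h| :=
      fun h hh => by
      have hlim : ∀ h ∈ Ioo (-ε) ε, Tendsto (fun r : ℝ => r⁻¹ • (evol B r (f t + h • g) -
          (f t + h • g))) (𝓝[>] 0) (𝓝 (app (B (f t + h • g)) (f t + h • g))) := fun h hh => by
        have h1 := (isSolution_evol (hm h hh).1).hasDerivWithinAt_Ioi ⟨le_rfl, hε⟩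
        simpa [StrangSplitting.evol_zero (hm h hh).1 hε.le] using
          hasDerivWithinAt_Ioi_iff_tendsto.1 h1
      have hl := ((hlim h (hsub hh)).sub (hlim 0 h00)).sub
        (tendsto_const_nhds (x := h • m (0, 0)))
      simp only [zero_smul, add_zero] at hl
      refine le_of_tendsto hl.norm ?_
      filter_upwards [Ioo_mem_nhdsGT hρ] with r hr
      have := e2 r ⟨hr.1.le, hr.2.le⟩ h hh
      have e : r⁻¹ • (evol B r (f t + h • g) - (f t + h • g)) - r⁻¹ • (evol B r (f t) - f t)
          - h • m (0, 0) = r⁻¹ • (evol B r (f t + h • g) - evol B r (f t) - h • g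
            - (h * r) • m (0, 0)) := by
        have hr0 := hr.1.ne'
        match_scalars <;> field_simp
        ring
      rw [e, norm_smul, Real.norm_of_nonneg (inv_nonneg.2 hr.1.le)]
      calc _ ≤ r⁻¹ * (δ * r * |h|) := mul_le_mul_of_nonneg_left this (inv_nonneg.2 hr.1.le)
        _ = _ := by have hr0 := hr.1.ne'; field_simp
    filter_upwards [Icc_mem_nhds (neg_lt_zero.2 hρ) hρ] with h hh
    simpa using e3 h hh
  obtain ⟨hd1, hd2⟩ := hreg.differentiable_op t ht htT
  obtain ⟨hc1, hc2⟩ := hreg.continuous_op t ht htT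
  rw [← hg] at hd1 hd2 hc1 hc2
  -- Product rule for B(f₀ + h g)(f₀ + h g): in the term h B(f₀ + h g) g the factor h makes
  -- continuity at 0 sufficient.
  have hk : HasDerivAt (fun h : ℝ => h • app (B (f t + h • g)) g) (app (B (f t)) g) 0 := by
    rw [hasDerivAt_iff_tendsto_slope_zero]
    have h1 : Tendsto (fun h : ℝ => app (B (f t + h • g)) g) (𝓝[≠] 0) (𝓝 (app (B (f t)) g)) := by
      simpa using hc2.tendsto.mono_left nhdsWithin_le_nhds
    refine h1.congr' ?_
    filter_upwards [self_mem_nhdsWithin] with h hh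
    simp [inv_smul_smul₀ hh]
  have hsum : HasDerivAt (fun h : ℝ => app (B (f t + h • g)) (f t + h • g))
      (opDeriv B (f t) g (f t) + app (B (f t)) g) 0 := by
    refine (hd2.hasDerivAt.add hk).congr_of_eventuallyEq ?_
    filter_upwards [hd1, hc1] with h h1 h2
    rw [Pi.add_apply, app_add h1 (Submodule.smul_mem _ _ h2), app_smul _ h2]
  have h1 := ((hm 0 h00).2 0 ⟨le_rfl, hε.le⟩).2
  rw [hmain.unique hsum, add_comm (opDeriv _ _ _ _)] at h1
  simp only [zero_smul, add_zero] at h1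
  exact h1.mono_of_mem_nhdsWithin (Icc_mem_nhdsGE hε)

end along

/-! ### Expansion of the symmetric product `e^{σA} V e^{σA}` -/

theorem mem_anticomm_domain {E F : X →ₗ.[ℝ] X} {x : X} :
    x ∈ (anticomm E F).domain ↔ (x ∈ F.domain ∧ app F x ∈ E.domain) ∧
      (x ∈ E.domain ∧ app E x ∈ F.domain) := by
  rw [anticomm, mem_add_domain, mem_opMul_domain, mem_opMul_domain]

theorem app_anticomm {E F : X →ₗ.[ℝ] X} {x : X} (h : x ∈ (anticomm E F).domain) :
    app (anticomm E F) x = app E (app F x) + app F (app E x) := by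
  rw [anticomm] at h ⊢
  rw [app_add_op h, app_opMul h.1, app_opMul h.2]

namespace C0Semigroup

variable {S : C0Semigroup X} {W : X →ₗ.[ℝ] X} {x : X}

theorem exists_of_mem_anticomm (h : x ∈ (anticomm S.generator W).domain) :
    ∃ x₁ y, S.HasGen x x₁ ∧ S.HasGen (app W x) y ∧
      app (anticomm S.generator W) x = y + app W x₁ := by
  obtain ⟨⟨-, h2⟩, h3, -⟩ := mem_anticomm_domain.1 h
  exact ⟨_, _, hasGen_app h3, hasGen_app h2, app_anticomm h⟩

/-- The natural domain only says that the sum A W x + W A x lies in D(A). Since A x is in the domain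
of `anticomm S.generator W`, the term W A x lies in D(A) by itself, and subtraction isolates A W x.
-/
theorem exists_of_mem_anticomm_anticomm
    (h : x ∈ (anticomm S.generator (anticomm S.generator W)).domain) :
    ∃ x₁ x₂ y₀₁ y₀₂ y₁₁, S.HasGen x x₁ ∧ S.HasGen x₁ x₂ ∧ S.HasGen (app W x) y₀₁ ∧
      S.HasGen y₀₁ y₀₂ ∧ S.HasGen (app W x₁) y₁₁ ∧
      app (anticomm S.generator (anticomm S.generator W)) x =
        y₀₂ + (2 : ℝ) • y₁₁ + app W x₂ := by
  obtain ⟨⟨h1, h2⟩, h3, h4⟩ := mem_anticomm_domain.1 h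
  obtain ⟨x₁, y, hx, hy, e⟩ := exists_of_mem_anticomm h1
  have e' := app_anticomm h
  rw [hx.app_eq] at h4 e'
  obtain ⟨x₂, y', hx', hy', e2⟩ := exists_of_mem_anticomm h4
  rw [e] at h2 e'
  have h5 := (hasGen_app h2).sub hy'
  rw [add_sub_cancel_right] at h5
  refine ⟨x₁, x₂, y, _, y', hx, hx', hy, h5, hy', ?_⟩
  rw [e', e2]
  module

/-- The same subtraction, one order higher; the coefficients 1, 3, 3, 1 are binomial. -/
theorem exists_of_mem_anticomm_three
    (h : x ∈ (anticomm S.generator (anticomm S.generator (anticomm S.generator W))).domain) :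
    ∃ x₁ x₂ x₃ y₀₁ y₀₂ y₀₃ y₁₁ y₁₂ y₂₁, S.HasGen x x₁ ∧ S.HasGen x₁ x₂ ∧ S.HasGen x₂ x₃ ∧
      S.HasGen (app W x) y₀₁ ∧ S.HasGen y₀₁ y₀₂ ∧ S.HasGen y₀₂ y₀₃ ∧
      S.HasGen (app W x₁) y₁₁ ∧ S.HasGen y₁₁ y₁₂ ∧ S.HasGen (app W x₂) y₂₁ ∧
      app (anticomm S.generator (anticomm S.generator (anticomm S.generator W))) x =
        y₀₃ + (3 : ℝ) • y₁₂ + (3 : ℝ) • y₂₁ + app W x₃ := by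
  obtain ⟨⟨h1, h2⟩, h3, h4⟩ := mem_anticomm_domain.1 h
  obtain ⟨x₁, x₂, y₀₁, y₀₂, y₁₁, hx₁, hx₂, hy₀₁, hy₀₂, hy₁₁, e⟩ :=
    exists_of_mem_anticomm_anticomm h1
  have e' := app_anticomm h
  rw [hx₁.app_eq] at h4 e'
  obtain ⟨x₂', x₃, y₁₁', y₁₂, y₂₁, hx₂', hx₃, hy₁₁', hy₁₂, hy₂₁, e2⟩ :=
    exists_of_mem_anticomm_anticomm h4
  obtain rfl := hx₂.unique hx₂'
  obtain rfl := hy₁₁.unique hy₁₁'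
  rw [e] at h2 e'
  have h5 := ((hasGen_app h2).sub hy₂₁).sub (hy₁₂.smul 2)
  rw [add_sub_cancel_right, add_sub_cancel_right] at h5
  refine ⟨x₁, x₂, x₃, y₀₁, y₀₂, _, y₁₁, y₁₂, y₂₁, hx₁, hx₂, hx₃, hy₀₁, hy₀₂, h5, hy₁₁, hy₁₂,
    hy₂₁, ?_⟩
  rw [e', e2]
  module

/-- The symmetric product `S(σ) V S(σ)`. -/
def sandwich (S : C0Semigroup X) (V : X →L[ℝ] X) (σ : ℝ) : X →L[ℝ] X :=
  (S.at' σ).comp (V.comp (S.at' σ))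

theorem sandwich_apply (S : C0Semigroup X) (V : X →L[ℝ] X) (σ : ℝ) (x : X) :
    S.sandwich V σ x = S.at' σ (V (S.at' σ x)) := rfl

variable [CompleteSpace X]

theorem continuousOn_sandwich (S : C0Semigroup X) (V : X →L[ℝ] X) (b : ℝ) (x : X) :
    ContinuousOn (fun σ => S.sandwich V σ x) (Icc 0 b) := by
  obtain ⟨M, -, hM⟩ := S.exists_norm_at'_le b
  exact continuousOn_clm_apply_of_bounded (L := S.at') (fun σ hσ => hM σ hσ.2)
    (fun y => (S.continuous_at' y).continuousOn)
    (V.continuous.comp (S.continuous_at' x)).continuousOn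

/-- V S(σ) x need not lie in D(A), so the product itself need not be differentiable. The average
maps into D(A) and replaces the missing term by the bounded `quot`. -/
theorem hasDerivWithinAt_avg_sandwich (S : C0Semigroup X) (V : X →L[ℝ] X) {h σ : ℝ} (hh : 0 ≤ h)
    (hσ : 0 ≤ σ) {x x₁ : X} (hx : S.HasGen x x₁) :
    HasDerivWithinAt (fun σ => S.avg h (S.sandwich V σ x))
      (S.quot h (S.sandwich V σ x) + S.avg h (S.sandwich V σ x₁)) (Ici σ) σ := by
  rw [← hasDerivWithinAt_Ioi_iff_Ici, hasDerivWithinAt_Ioi_iff_tendsto]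
  obtain ⟨M, -, hM⟩ := S.exists_norm_at'_le (σ + 1)
  have h1 := hasDerivWithinAt_Ioi_iff_tendsto.1 (hx.hasDerivWithinAt hσ)
  have h2 : Tendsto (fun r : ℝ => S.at' (σ + r) (V (r⁻¹ • (S.at' (σ + r) x - S.at' σ x)))) (𝓝[>] 0)
      (𝓝 (S.at' σ (V (S.at' σ x₁)))) := by
    refine tendsto_clm_apply_of_bounded (N := M) (L := fun r => S.at' (σ + r)) ?_ ?_
      ((V.continuous.tendsto _).comp h1)
    · filter_upwards [Ioo_mem_nhdsGT (zero_lt_one' ℝ)] with r hr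
      exact hM _ (by linarith [hr.2])
    · have : Continuous fun r : ℝ => S.at' (σ + r) (V (S.at' σ x₁)) :=
        (S.continuous_at' _).comp (continuous_const_add σ)
      simpa using (this.tendsto 0).mono_left (nhdsWithin_le_nhds (s := Ioi 0))
  have h3 := hasDerivWithinAt_Ioi_iff_tendsto.1
    ((S.hasGen_avg hh (V (S.at' σ x))).hasDerivWithinAt hσ)
  rw [← S.quot_at'_comm hh hσ] at h3
  refine (h3.add (((S.avg h).continuous.tendsto _).comp h2)).congr' ?_
  filter_upwards [self_mem_nhdsWithin] with r hr
  have hr' : 0 ≤ σ + r := add_nonneg hσ (le_of_lt hr)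
  simp only [sandwich_apply, Function.comp, map_smul, map_sub, ← S.avg_at'_comm hh hσ,
    ← S.avg_at'_comm hh hr']
  module

theorem tendsto_avg_three (S : C0Semigroup X) (x : X) :
    Tendsto (fun h => S.avg h (S.avg h (S.avg h x))) (𝓝[>] 0) (𝓝 x) := by
  obtain ⟨M, -, hM⟩ := S.exists_norm_at'_le 1
  have hN : ∀ᶠ h in 𝓝[>] (0 : ℝ), ‖S.avg h‖ ≤ M := by
    filter_upwards [Ioo_mem_nhdsGT (zero_lt_one' ℝ)] with h hh
    exact norm_avg_le hh.1 fun t ht => hM t (ht.trans hh.2.le)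
  exact tendsto_clm_apply_of_bounded hN (S.tendsto_avg x)
    (tendsto_clm_apply_of_bounded hN (S.tendsto_avg x) (S.tendsto_avg x))

/-- Taylor expansion of second order of `σ ↦ S(σ) V S(σ) x₀`, whose third derivative is bounded
only as a whole. The difference quotients need not converge term by term, so the function is first
smoothed by the averages of the semigroup. -/
theorem norm_sandwich_taylor_le (S : C0Semigroup X) (V : X →L[ℝ] X) {M η C : ℝ} (hη : 0 ≤ η)
    (hM : ∀ t ≤ 1, ‖S.at' t‖ ≤ M) {x₀ x₁ x₂ x₃ y₀₁ y₀₂ y₁₁ : X} (hx₀ : S.HasGen x₀ x₁)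
    (hx₁ : S.HasGen x₁ x₂) (hx₂ : S.HasGen x₂ x₃) (hy₀ : S.HasGen (V x₀) y₀₁)
    (hy₁ : S.HasGen y₀₁ y₀₂) (hy₂ : S.HasGen (V x₁) y₁₁)
    (hC : ∀ σ ∈ Icc 0 η, ∃ z₀₁ z₀₂ z₀₃ z₁₁ z₁₂ z₂₁, S.HasGen (S.sandwich V σ x₀) z₀₁ ∧
      S.HasGen z₀₁ z₀₂ ∧ S.HasGen z₀₂ z₀₃ ∧ S.HasGen (S.sandwich V σ x₁) z₁₁ ∧
      S.HasGen z₁₁ z₁₂ ∧ S.HasGen (S.sandwich V σ x₂) z₂₁ ∧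
      ‖z₀₃ + (3 : ℝ) • z₁₂ + (3 : ℝ) • z₂₁ + S.sandwich V σ x₃‖ ≤ C) :
    ‖S.sandwich V η x₀ - V x₀ - η • (y₀₁ + V x₁) -
      (η ^ 2 / 2) • (y₀₂ + (2 : ℝ) • y₁₁ + V x₂)‖ ≤ M ^ 3 * C * η ^ 3 := by
  have hM0 : 0 ≤ M := (norm_nonneg _).trans (hM 0 zero_le_one)
  have hC0 : 0 ≤ C := by
    obtain ⟨_, _, _, _, _, _, -, -, -, -, -, -, h⟩ := hC 0 ⟨le_rfl, hη⟩
    exact (norm_nonneg _).trans h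
  refine le_of_tendsto (S.tendsto_avg_three _).norm ?_
  filter_upwards [Ioo_mem_nhdsGT (zero_lt_one' ℝ)] with h hh
  have hh0 := hh.1.le
  have hJ : ‖S.avg h‖ ≤ M := norm_avg_le hh.1 fun t ht => hM t (ht.trans hh.2.le)
  set J := S.avg h with hJdef
  set D := S.quot h with hDdef
  set W := S.sandwich V with hW
  have hJD : ∀ z, J (D z) = D (J z) := S.avg_quot_comm hh0
  have hcont : ∀ (L : X →L[ℝ] X) x, ContinuousOn (fun σ => L (J (W σ x))) (Icc 0 η) := fun L x =>
    L.continuous.comp_continuousOn (J.continuous.comp_continuousOn (S.continuousOn_sandwich V η x))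
  have hder : ∀ (L : X →L[ℝ] X) {x x' : X}, S.HasGen x x' → ∀ σ ∈ Ico 0 η,
      HasDerivWithinAt (fun σ => L (J (W σ x))) (L (D (W σ x) + J (W σ x'))) (Ici σ) σ :=
    fun L x x' hx σ hσ => L.hasFDerivAt.comp_hasDerivWithinAt σ
      (S.hasDerivWithinAt_avg_sandwich V hh0 hσ.1 hx)
  -- The smoothed function is J³ W(σ) x₀. Each differentiation either trades a J for a D or moves
  -- from xᵢ to xᵢ₊₁. Three factors J suffice for three derivatives, and in G₃ the relation J A = D
  -- reassembles J³ applied to the whole triple anticommutator.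
  have key := norm_taylor_two_le (τ := η) (K := M ^ 3 * C)
    (G₀ := fun σ => (J.comp J) (J (W σ x₀)))
    (G₁ := fun σ => (J.comp D) (J (W σ x₀)) + (J.comp J) (J (W σ x₁)))
    (G₂ := fun σ => (D.comp D) (J (W σ x₀)) + (2 : ℝ) • (J.comp D) (J (W σ x₁)) +
      (J.comp J) (J (W σ x₂)))
    (G₃ := fun σ => (D.comp D) (D (W σ x₀) + J (W σ x₁)) +
      (2 : ℝ) • (J.comp D) (D (W σ x₁) + J (W σ x₂)) + (J.comp J) (D (W σ x₂) + J (W σ x₃)))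
    hη (hcont _ _) ((hcont _ _).add (hcont _ _))
    (((hcont _ _).add ((hcont _ _).const_smul _)).add (hcont _ _))
    (fun σ hσ => by
      convert hder (J.comp J) hx₀ σ hσ using 1
      simp [hJD])
    (fun σ hσ => by
      convert (hder (J.comp D) hx₀ σ hσ).fun_add (hder (J.comp J) hx₁ σ hσ) using 1
      simp only [ContinuousLinearMap.comp_apply, map_add, hJD]
      module)
    (fun σ hσ => ((hder (D.comp D) hx₀ σ hσ).add ((hder (J.comp D) hx₁ σ hσ).const_smul (2 : ℝ))).add
      (hder (J.comp J) hx₂ σ hσ))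
    (by positivity) (fun σ hσ => by
      obtain ⟨z₀₁, z₀₂, z₀₃, z₁₁, z₁₂, z₂₁, g1, g2, g3, g4, g5, g6, hz⟩ := hC σ ⟨hσ.1, hσ.2.le⟩
      have e : (D.comp D) (D (W σ x₀) + J (W σ x₁)) +
          (2 : ℝ) • (J.comp D) (D (W σ x₁) + J (W σ x₂)) + (J.comp J) (D (W σ x₂) + J (W σ x₃)) =
          J (J (J (z₀₃ + (3 : ℝ) • z₁₂ + (3 : ℝ) • z₂₁ + W σ x₃))) := by
        have j1 : J z₀₁ = D (W σ x₀) := g1.avg_eq hh0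
        have j2 : J z₀₂ = D z₀₁ := g2.avg_eq hh0
        have j3 : J z₀₃ = D z₀₂ := g3.avg_eq hh0
        have j4 : J z₁₁ = D (W σ x₁) := g4.avg_eq hh0
        have j5 : J z₁₂ = D z₁₁ := g5.avg_eq hh0
        have j6 : J z₂₁ = D (W σ x₂) := g6.avg_eq hh0
        simp only [ContinuousLinearMap.comp_apply, map_add, map_smul, j3, j5, j6, hJD, j2, j4, j1]
        module
      rw [e]
      calc _ ≤ M * (M * (M * C)) :=
            J.le_of_opNorm_le_of_le hJ (J.le_of_opNorm_le_of_le hJ (J.le_of_opNorm_le_of_le hJ hz))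
        _ = _ := by ring)
  refine le_of_eq_of_le ?_ key
  have hW0 : ∀ x, W 0 x = V x := fun x => by simp [hW, sandwich_apply]
  have j1 : J y₀₁ = D (V x₀) := hy₀.avg_eq hh0
  have j2 : J y₀₂ = D y₀₁ := hy₁.avg_eq hh0
  have j3 : J y₁₁ = D (V x₁) := hy₂.avg_eq hh0
  simp only [hW0, ContinuousLinearMap.comp_apply, map_add, map_sub, map_smul, j2, j3, hJD, j1]

end C0Semigroup

/-- Expansion of one step of the Strang splitting with a frozen generator. -/
theorem norm_strang_step_le [CompleteSpace X] {S R : C0Semigroup X} {Bt : X →ₗ.[ℝ] X}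
    (hS : ∀ t, expOp S.generator t = S.at' t) (hR : ∀ t, expOp Bt t = R.at' t) {M τ C : ℝ}
    (hτ : 0 ≤ τ) (hM : ∀ t ≤ 1, ‖S.at' t‖ ≤ M) {x₀ : X}
    (h : ∀ s ∈ Icc 0 τ, NormLE (anticomm S.generator (anticomm S.generator (anticomm S.generator
      (expOp' S.generator (s / 2) ⬝ₒ expOp' Bt τ ⬝ₒ expOp' S.generator (s / 2))))) x₀ C) :
    ∃ x₁ x₂ y₀₁ y₀₂ y₁₁, S.HasGen x₀ x₁ ∧ S.HasGen x₁ x₂ ∧ S.HasGen (R.at' τ x₀) y₀₁ ∧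
      S.HasGen y₀₁ y₀₂ ∧ S.HasGen (R.at' τ x₁) y₁₁ ∧
      ‖S.at' (τ / 2) (R.at' τ (S.at' (τ / 2) x₀)) - R.at' τ x₀ -
        (τ / 2) • (y₀₁ + R.at' τ x₁) -
        (τ ^ 2 / 8) • (y₀₂ + (2 : ℝ) • y₁₁ + R.at' τ x₂)‖ ≤ M ^ 3 * C * τ ^ 3 := by
  have happ : ∀ σ x, app (expOp' S.generator σ ⬝ₒ expOp' Bt τ ⬝ₒ
      expOp' S.generator σ) x = S.sandwich (R.at' τ) σ x := fun σ x => by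
    have h1 : x ∈ (expOp' Bt τ ⬝ₒ expOp' S.generator σ).domain :=
      mem_opMul_domain.2 ⟨mem_total_domain _ _, mem_total_domain _ _⟩
    rw [app_opMul (mem_opMul_domain.2 ⟨h1, mem_total_domain _ _⟩), app_opMul h1]
    simp [hS, hR, C0Semigroup.sandwich_apply]
  obtain ⟨x₁, x₂, x₃, y₀₁, y₀₂, y₀₃, y₁₁, y₁₂, y₂₁, hx₁, hx₂, hx₃, g1, g2, g3, g4, g5, g6, -⟩ :=
    C0Semigroup.exists_of_mem_anticomm_three (h 0 ⟨le_rfl, hτ⟩).1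
  simp only [happ, zero_div, C0Semigroup.sandwich_apply, C0Semigroup.at'_zero,
    ContinuousLinearMap.id_apply] at g1 g4 g6
  refine ⟨x₁, x₂, y₀₁, y₀₂, y₁₁, hx₁, hx₂, g1, g2, g4, ?_⟩
  have hC0 : 0 ≤ C := (norm_nonneg _).trans (h 0 ⟨le_rfl, hτ⟩).2
  have hM0 : 0 ≤ M := (norm_nonneg _).trans (hM 0 zero_le_one)
  -- The outer factors are e^{(s/2)A}, so σ corresponds to s = 2σ and the expansion runs up to η =
  -- τ/2.
  have key := S.norm_sandwich_taylor_le (R.at' τ) (η := τ / 2) (C := C) (by linarith) hM hx₁ hx₂ hx₃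
    g1 g2 g4 fun σ hσ => by
      have hσ' : 2 * σ ∈ Icc 0 τ := ⟨by linarith [hσ.1], by linarith [hσ.2]⟩
      obtain ⟨x₁', x₂', x₃', z₀₁, z₀₂, z₀₃, z₁₁, z₁₂, z₂₁, hx₁', hx₂', hx₃', g1, g2, g3, g4, g5,
        g6, e⟩ := C0Semigroup.exists_of_mem_anticomm_three (h _ hσ').1
      obtain rfl := hx₁.unique hx₁'
      obtain rfl := hx₂.unique hx₂'
      obtain rfl := hx₃.unique hx₃'
      have hn := (h _ hσ').2
      rw [e] at hn
      simp only [happ, mul_div_cancel_left₀ σ (two_ne_zero' ℝ)] at g1 g4 g6 hn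
      exact ⟨z₀₁, z₀₂, z₀₃, z₁₁, z₁₂, z₂₁, g1, g2, g3, g4, g5, g6, hn⟩
  have e : (τ / 2) ^ 2 / 2 = τ ^ 2 / 8 := by ring
  rw [e] at key
  refine key.trans ?_
  have : (τ / 2) ^ 3 ≤ τ ^ 3 := by
    have : (τ / 2) ^ 3 = τ ^ 3 / 8 := by ring
    have := pow_nonneg hτ 3
    linarith
  exact mul_le_mul_of_nonneg_left this (by positivity)

/-! ### Expansion of the exact solution -/

section exact

variable {S : C0Semigroup X} {B : X → X →ₗ.[ℝ] X} {T C : ℝ} {f : ℝ → X}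

/-- The triple product is read off from the step that starts at time 0 and has length a, so that the
four times are absolute and arbitrary up to T. -/
theorem evolDeriv_linear_bounds
    (hest : ∀ t τ : ℝ, 0 ≤ t → 0 < τ → t + τ ≤ T → Estimates S.generator B f t τ C)
    {a b c d : ℝ} (hd : 0 ≤ d) (hdc : d ≤ c) (hcb : c ≤ b) (hba : b ≤ a) (ha : 0 < a)
    (haT : a ≤ T) :
    f d ∈ S.generator.domain ∧
    evolDeriv B (c - d) (f d) (app S.generator (f d)) ∈ S.generator.domain ∧
    evolDeriv B (b - c) (f c) (app S.generator
      (evolDeriv B (c - d) (f d) (app S.generator (f d)))) ∈ S.generator.domain ∧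
    ‖evolDeriv B (a - b) (f b) (app S.generator (evolDeriv B (b - c) (f c) (app S.generator
      (evolDeriv B (c - d) (f d) (app S.generator (f d))))))‖ ≤ C := by
  have h := (hest 0 a le_rfl ha (by simpa using haT)).third_order_exact b c d hd hdc hcb hba
  simp only [zero_add] at h
  obtain ⟨h1, hn⟩ := h
  obtain ⟨h2, -⟩ := mem_opMul_domain.1 h1
  obtain ⟨h3, h3'⟩ := mem_opMul_domain.1 h2
  obtain ⟨h4, -⟩ := mem_opMul_domain.1 h3
  obtain ⟨h5, h5'⟩ := mem_opMul_domain.1 h4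
  obtain ⟨h6, -⟩ := mem_opMul_domain.1 h5
  rw [app_opMul h1, app_opMul h2, app_opMul h3, app_opMul h4, app_opMul h5] at hn
  rw [app_opMul h3, app_opMul h4, app_opMul h5] at h3'
  rw [app_opMul h5] at h5'
  simp only [app_total, ContinuousLinearMap.coe_coe] at hn h3' h5'
  exact ⟨h6, h5', h3', hn⟩

/-- The kernel k is Lipschitz in each variable. The path from (0, 0) via (s, 0) to (s, σ) stays in
the triangle, and k(0, 0) = ∂₂E_B(τ, f₀)A² f₀. -/
theorem cubature_kernel (hreg : RegularAlong S.generator B T f) {t τ : ℝ} (ht : 0 ≤ t)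
    (hτ : 0 < τ) (htτ : t + τ ≤ T) (h : Estimates S.generator B f t τ C) {s σ : ℝ}
    (hσ : 0 ≤ σ) (hσs : σ ≤ s) (hsτ : s ≤ τ) :
    evol B σ (f t) ∈ S.generator.domain ∧
    evolDeriv B (s - σ) (f (t + σ)) (app S.generator (evol B σ (f t))) ∈ S.generator.domain ∧
    ‖evolDeriv B (τ - s) (f (t + s)) (app S.generator (evolDeriv B (s - σ) (f (t + σ))
      (app S.generator (evol B σ (f t))))) -
      evolDeriv B τ (f t) (app S.generator (app S.generator (f t)))‖ ≤ 2 * C * τ := by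
  have hmem : ∀ s ∈ Icc 0 τ, ∀ σ ∈ Icc 0 s, evol B σ (f t) ∈ S.generator.domain ∧
      evolDeriv B (s - σ) (f (t + σ)) (app S.generator (evol B σ (f t))) ∈ S.generator.domain ∧
      app (S.generator ⬝ₒ evolDerivOp B (s - σ) (f (t + σ)) ⬝ₒ S.generator) (evol B σ (f t)) =
        app S.generator (evolDeriv B (s - σ) (f (t + σ))
          (app S.generator (evol B σ (f t)))) := fun s hs σ hσ => by
    have h1 := h.cubature_mem s hs σ hσ
    obtain ⟨h2, h2'⟩ := mem_opMul_domain.1 h1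
    obtain ⟨h3, -⟩ := mem_opMul_domain.1 h2
    rw [app_opMul h1]
    rw [app_opMul h2] at h2' ⊢
    simp only [app_total, ContinuousLinearMap.coe_coe] at h2' ⊢
    exact ⟨h3, h2', trivial⟩
  have hs0 : 0 ≤ s := hσ.trans hσs
  obtain ⟨m1, m2, e1⟩ := hmem s ⟨hs0, hsτ⟩ σ ⟨hσ, hσs⟩
  refine ⟨m1, m2, ?_⟩
  have hC : 0 ≤ C := (norm_nonneg _).trans
    ((h.cubature_fst 0 ⟨le_rfl, hτ.le⟩).2 0 ⟨le_rfl, hτ.le⟩)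
  have d1 := (h.cubature_snd s ⟨hs0, hsτ⟩).norm_sub_le (x := 0) (y := σ) ⟨le_rfl, hs0⟩ ⟨hσ, hσs⟩
  have d2 := (h.cubature_fst 0 ⟨le_rfl, hτ.le⟩).norm_sub_le (x := 0) (y := s) ⟨le_rfl, hτ.le⟩
    ⟨hs0, hsτ⟩
  have hu0 : evol B 0 (f t) = f t := hreg.evol_zero ⟨ht, by linarith⟩
  have e00 := (hmem 0 ⟨le_rfl, hτ.le⟩ 0 ⟨le_rfl, le_rfl⟩).2.2
  simp only [e1] at d1
  simp only [e00] at d2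
  simp only [sub_zero, add_zero, hu0, hreg.evolDeriv_zero ⟨ht, by linarith⟩,
    ContinuousLinearMap.id_apply, abs_of_nonneg hσ, abs_of_nonneg hs0] at d1 d2
  calc _ ≤ _ := norm_sub_le_norm_sub_add_norm_sub _ _ _
    _ ≤ C * σ + C * s := add_le_add d1 d2
    _ ≤ C * τ + C * τ := add_le_add (mul_le_mul_of_nonneg_left (hσs.trans hsτ) hC)
        (mul_le_mul_of_nonneg_left hsτ hC)
    _ = _ := by ring

/-- `A ∂₂E(a - b, f(b)) A f(b)` is bounded. -/
theorem exists_norm_linear_evolDeriv_le [CompleteSpace X] (hreg : RegularAlong S.generator B T f)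
    (hf : IsSolution (fun v => S.generator + B v) T f)
    (hest : ∀ t τ : ℝ, 0 ≤ t → 0 < τ → t + τ ≤ T → Estimates S.generator B f t τ C) :
    ∃ K, ∀ a b, 0 < b → b ≤ a → a ≤ T →
      ‖app S.generator (evolDeriv B (a - b) (f b) (app S.generator (f b)))‖ ≤ K := by
  obtain ⟨M, -, hM⟩ := S.exists_norm_at'_le 1
  obtain ⟨N, hN0, hN⟩ := hreg.exists_norm_evolDeriv_le
  obtain ⟨K₁, hK₁⟩ := isCompact_Icc.exists_bound_of_continuousOn (hreg.continuousOn_linear hf)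
  set K₂ := (M + 1) * K₁ + M * C with hK₂
  -- A f is bounded by compactness, A³ f by the triple product with all times equal; Landau's
  -- inequality bounds A² f.
  have hA2 : ∀ b, 0 < b → b ≤ T → ‖app S.generator (app S.generator (f b))‖ ≤ K₂ :=
    fun b hb hbT => by
    obtain ⟨-, h2, h3, h4⟩ := evolDeriv_linear_bounds hest hb.le le_rfl le_rfl le_rfl hb hbT
    simp only [sub_self, hreg.evolDeriv_zero ⟨hb.le, hbT⟩, ContinuousLinearMap.id_apply]
      at h2 h3 h4
    exact C0Semigroup.norm_hasGen_le hM (C0Semigroup.hasGen_app h2) (C0Semigroup.hasGen_app h3)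
      (hK₁ b ⟨hb.le, hbT⟩) h4
  refine ⟨2 * |C| * T + (N + 1) * |K₂|, fun a b hb hba haT => ?_⟩
  have hbT := hba.trans haT
  have hK := hA2 b hb hbT
  have h0 : 0 ≤ 2 * |C| * T := by
    have := hb.le.trans hbT
    positivity
  rcases hba.eq_or_lt with rfl | hlt
  · simp only [sub_self, hreg.evolDeriv_zero ⟨hb.le, hbT⟩, ContinuousLinearMap.id_apply]
    nlinarith [le_abs_self K₂, abs_nonneg K₂, mul_nonneg hN0 (abs_nonneg K₂)]
  -- For the step from b to a, the corner value k(τ, 0) is the vector to be bounded.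
  · obtain ⟨-, -, h3⟩ := cubature_kernel hreg hb.le (sub_pos.2 hlt) (by simpa using haT)
      (hest b (a - b) hb.le (sub_pos.2 hlt) (by simpa using haT)) (s := a - b) (σ := 0)
      le_rfl (sub_pos.2 hlt).le le_rfl
    simp only [sub_self, sub_zero, add_zero, add_sub_cancel, hreg.evol_zero ⟨hb.le, hbT⟩,
      hreg.evolDeriv_zero ⟨hb.le.trans hba, haT⟩, ContinuousLinearMap.id_apply] at h3
    have h4 := (evolDeriv B (a - b) (f b)).le_of_opNorm_le_of_le (hN a b hb.le hba haT) hK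
    have h5 := norm_le_norm_sub_add (app S.generator (evolDeriv B (a - b) (f b)
      (app S.generator (f b)))) (evolDeriv B (a - b) (f b)
        (app S.generator (app S.generator (f b))))
    have h6 : 2 * C * (a - b) ≤ 2 * |C| * T := by
      have h7 : C * (a - b) ≤ |C| * (a - b) :=
        mul_le_mul_of_nonneg_right (le_abs_self C) (sub_pos.2 hlt).le
      have h8 : |C| * (a - b) ≤ |C| * T :=
        mul_le_mul_of_nonneg_left (by linarith) (abs_nonneg C)
      linarith
    have h7 : N * K₂ ≤ N * |K₂| := mul_le_mul_of_nonneg_left (le_abs_self _) hN0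
    nlinarith [abs_nonneg K₂]

/-- Expansion of one step of the exact solution around the evolution of the nonlinear part. -/
theorem norm_exact_step_le [CompleteSpace X] (hreg : RegularAlong S.generator B T f)
    (hf : IsSolution (fun v => S.generator + B v) T f)
    (hest : ∀ t τ : ℝ, 0 ≤ t → 0 < τ → t + τ ≤ T → Estimates S.generator B f t τ C)
    {t τ : ℝ} (ht : 0 ≤ t) (hτ : 0 < τ) (htτ : t + τ ≤ T) :
    ‖f (t + τ) - evol B τ (f t) -
      (τ / 2) • (evolDeriv B τ (f t) (app S.generator (f t)) +
        app S.generator (evol B τ (f t))) -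
      (τ ^ 2 / 2) • evolDeriv B τ (f t) (app S.generator (app S.generator (f t)))‖
        ≤ 5 * C * τ ^ 3 := by
  obtain ⟨K, hK⟩ := exists_norm_linear_evolDeriv_le hreg hf hest
  have hest' := hest t τ ht hτ htτ
  set A := S.generator with hA
  have hC : 0 ≤ C := (norm_nonneg _).trans
    ((hest'.cubature_fst 0 ⟨le_rfl, hτ.le⟩).2 0 ⟨le_rfl, hτ.le⟩)
  set u : ℝ → X := fun s => evol B s (f t) with hu
  set v : ℝ → X := fun s => app A (f (t + s)) with hv
  set E : ℝ → ℝ → X →L[ℝ] X := fun s σ => evolDeriv B (s - σ) (f (t + σ)) with hE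
  have hEss : ∀ s ∈ Icc 0 τ, E s s = ContinuousLinearMap.id ℝ X := fun s hs => by
    simp only [hE, sub_self]
    exact hreg.evolDeriv_zero ⟨by linarith [hs.1], by linarith [hs.2]⟩
  have hE' : ∀ s σ, E s σ = evolDeriv B (t + s - (t + σ)) (f (t + σ)) := fun s σ => by
    simp only [hE, add_sub_add_left_eq_sub]
  have hvc : ContinuousOn v (Icc 0 τ) := (hreg.continuousOn_linear hf).comp
    (f := fun s => t + s) (by fun_prop) fun s hs => ⟨by linarith [hs.1], by linarith [hs.2]⟩
  have hEvc : ∀ s ≤ τ, ContinuousOn (fun σ => E s σ (v σ)) (Icc 0 s) := fun s hs => by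
    have h1 := hreg.continuousOn_evolDeriv (a := t + s) (by linarith) Subset.rfl
      ((hreg.continuousOn_linear hf).mono (Icc_subset_Icc_right (by linarith)))
    refine (h1.comp (f := fun σ => t + σ) (s := Icc 0 s) (by fun_prop)
      fun σ hσ => ⟨by linarith [hσ.1], by linarith [hσ.2]⟩).congr fun σ hσ => ?_
    simp only [hE', hv, Function.comp]
  have hEvi : ∀ s ∈ Icc 0 τ,
      IntervalIntegrable (fun σ => E s σ (v σ)) MeasureTheory.volume 0 s := fun s hs =>
    ContinuousOn.intervalIntegrable (by rw [uIcc_of_le hs.1]; exact hEvc s hs.2)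
  have hvoc : ∀ s ∈ Icc 0 τ, f (t + s) - u s = ∫ σ in (0 : ℝ)..s, E s σ (v σ) := fun s hs => by
    have h1 := hreg.sub_evol_eq_integral hf ht (a := t + s) (by linarith [hs.1])
      (by linarith [hs.2])
    rw [add_sub_cancel_left] at h1
    rw [hu, h1]
    have h2 := intervalIntegral.integral_comp_add_left (a := 0) (b := s)
      (fun b => evolDeriv B (t + s - b) (f b) (app A (f b))) t
    rw [add_zero] at h2
    rw [← h2]
    simp only [hE', hv]
  have hbd : ∀ {s σ ρ}, 0 < ρ → ρ ≤ σ → σ ≤ s → s ≤ τ →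
      S.HasGen (E σ ρ (v ρ)) (app A (E σ ρ (v ρ))) ∧
      S.HasGen (E s σ (app A (E σ ρ (v ρ)))) (app A (E s σ (app A (E σ ρ (v ρ))))) ∧
      ‖E τ s (app A (E s σ (app A (E σ ρ (v ρ)))))‖ ≤ C := fun {s σ ρ} hρ hρσ hσs hs => by
    obtain ⟨-, h1, h2, h3⟩ := evolDeriv_linear_bounds hest (a := t + τ) (b := t + s)
      (c := t + σ) (d := t + ρ) (by linarith) (by linarith) (by linarith) (by linarith)
      (by linarith) htτ
    simp only [← hE'] at h1 h2 h3
    exact ⟨C0Semigroup.hasGen_app h1, C0Semigroup.hasGen_app h2, h3⟩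
  have hbd' : ∀ {s σ ρ}, 0 < ρ → ρ ≤ σ → σ ≤ s → s ≤ τ →
      ‖app A (E s σ (app A (E σ ρ (v ρ))))‖ ≤ C := fun {s σ ρ} hρ hρσ hσs hs => by
    obtain ⟨-, -, -, h3⟩ := evolDeriv_linear_bounds hest (a := t + s) (b := t + s)
      (c := t + σ) (d := t + ρ) (by linarith) (by linarith) (by linarith) (by linarith)
      (by linarith) (by linarith)
    simp only [← hE', hEss s ⟨by linarith, hs⟩, ContinuousLinearMap.id_apply] at h3
    exact h3
  -- K only justifies moving A under the integral; it does not enter the final constant.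
  have hY : ∀ {s σ}, 0 < σ → σ ≤ s → s ≤ τ → ‖app A (E s σ (v σ))‖ ≤ K :=
    fun {s σ} hσ hσs hs => by
    rw [hE']
    exact hK (t + s) (t + σ) (by linarith) (by linarith) (by linarith)
  have hYint : ∀ s ∈ Icc 0 τ,
      IntervalIntegrable (fun σ => app A (E s σ (v σ))) MeasureTheory.volume 0 s ∧
      S.HasGen (f (t + s) - u s) (∫ σ in (0 : ℝ)..s, app A (E s σ (v σ))) := fun s hs => by
    rw [hvoc s hs]
    exact C0Semigroup.hasGen_integral hs.1 (hEvi s hs)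
      (fun σ hσ => (hbd hσ.1 hσ.2 le_rfl hs.2).1) fun σ hσ => hY hσ.1 hσ.2 hs.2
  have huA : ∀ s ∈ Icc 0 τ, S.HasGen (u s) (app A (u s)) := fun s hs =>
    C0Semigroup.hasGen_app (hest'.trapezoid_mem s hs)
  have hAw : ∀ s ∈ Icc 0 τ,
      v s - app A (u s) = ∫ σ in (0 : ℝ)..s, app A (E s σ (v σ)) := fun s hs => by
    have h1 : S.HasGen (f (t + s)) (v s) := C0Semigroup.hasGen_app
      (hf.mem_add_domain ⟨by linarith [hs.1], by linarith [hs.2]⟩).1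
    exact (h1.sub (huA s hs)).unique (hYint s hs).2
  set k₀ := evolDeriv B τ (f t) (app A (app A (f t))) with hk₀
  -- Replacing A f by A u in the inner argument costs one more integral, of a triple product bounded
  -- by C; the remaining kernel is within 2Cτ of its corner value.
  have hkey : ∀ {s σ}, 0 < σ → σ ≤ s → s ≤ τ →
      ‖E τ s (app A (E s σ (v σ))) - k₀‖ ≤ 3 * C * τ := fun {s σ} hσ hσs hs => by
    have hσ' : σ ∈ Icc 0 τ := ⟨hσ.le, hσs.trans hs⟩
    obtain ⟨-, m2, h1⟩ := cubature_kernel hreg ht hτ htτ hest' hσ.le hσs hs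
    have hi := (hYint σ hσ').1
    have e1 : E s σ (v σ) - E s σ (app A (u σ)) =
        ∫ ρ in (0 : ℝ)..σ, E s σ (app A (E σ ρ (v ρ))) := by
      rw [← map_sub, hAw σ hσ', ContinuousLinearMap.intervalIntegral_comp_comm _ hi]
    have hi' : IntervalIntegrable (fun ρ => E s σ (app A (E σ ρ (v ρ))))
        MeasureTheory.volume 0 σ :=
      ⟨(E s σ).integrable_comp hi.1, (E s σ).integrable_comp hi.2⟩
    obtain ⟨hi2, h2⟩ := C0Semigroup.hasGen_integral hσ.le hi'
      (fun ρ hρ => (hbd hρ.1 hρ.2 hσs hs).2.1) fun ρ hρ => hbd' hρ.1 hρ.2 hσs hs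
    rw [← e1] at h2
    have h3 := ((hbd hσ hσs le_rfl hs).1.sub (C0Semigroup.hasGen_app m2)).unique h2
    have h4 : ‖E τ s (app A (E s σ (v σ))) - E τ s (app A (E s σ (app A (u σ))))‖ ≤ C * σ := by
      rw [← map_sub]
      have h5 : E τ s (app A (E s σ (v σ)) - app A (E s σ (app A (u σ)))) =
          ∫ ρ in (0 : ℝ)..σ, E τ s (app A (E s σ (app A (E σ ρ (v ρ))))) := by
        rw [ContinuousLinearMap.intervalIntegral_comp_comm _ hi2, ← h3]
      rw [h5]
      have := intervalIntegral.norm_integral_le_of_norm_le_const (a := 0) (b := σ)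
        (f := fun ρ => E τ s (app A (E s σ (app A (E σ ρ (v ρ)))))) (C := C) fun ρ hρ => by
          rw [uIoc_of_le hσ.le] at hρ
          exact (hbd hρ.1 hρ.2 hσs hs).2.2
      rwa [sub_zero, abs_of_pos hσ] at this
    calc _ ≤ _ := norm_sub_le_norm_sub_add_norm_sub _ (E τ s (app A (E s σ (app A (u σ))))) _
      _ ≤ C * σ + 2 * C * τ := add_le_add h4 h1
      _ ≤ C * τ + 2 * C * τ := by gcongr; exact hσ'.2
      _ = _ := by ring
  have hΦ : ∀ s ∈ Icc 0 τ, ‖E τ s (v s - app A (u s)) - s • k₀‖ ≤ 3 * C * τ ^ 2 := fun s hs => by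
    have hi := (hYint s hs).1
    rw [hAw s hs, ← ContinuousLinearMap.intervalIntegral_comp_comm _ hi]
    have h1 := norm_intervalIntegral_sub_le (g := fun σ => E τ s (app A (E s σ (v σ))))
      (c := k₀) hs.1 ⟨(E τ s).integrable_comp hi.1, (E τ s).integrable_comp hi.2⟩
      fun σ hσ => hkey hσ.1 hσ.2 hs.2
    rw [sub_zero] at h1
    refine h1.trans ?_
    calc 3 * C * τ * s ≤ 3 * C * τ * τ := by gcongr; exact hs.2
      _ = _ := by ring
  have hτm : τ ∈ Icc 0 τ := ⟨hτ.le, le_rfl⟩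
  have htrap := hest'.trapezoid.norm_integral_sub_trapezoid_le hτ.le
  have htc : IntervalIntegrable (fun s => E τ s (app A (u s))) MeasureTheory.volume 0 τ :=
    ContinuousOn.intervalIntegrable (by
      rw [uIcc_of_le hτ.le]
      exact hest'.trapezoid.continuousOn)
  have hwi : IntervalIntegrable (fun s => E τ s (v s - app A (u s))) MeasureTheory.volume 0 τ := by
    simpa only [map_sub] using (hEvi τ hτm).sub htc
  have hsk : IntervalIntegrable (fun s : ℝ => s • k₀) MeasureTheory.volume 0 τ :=
    (continuous_id.smul continuous_const).intervalIntegrable _ _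
  have hw := norm_intervalIntegral_sub_le (c := (0 : X)) hτ.le (hwi.sub hsk) fun s hs => by
    rw [sub_zero]
    exact hΦ s ⟨hs.1.le, hs.2⟩
  rw [intervalIntegral.integral_sub hwi hsk, intervalIntegral.integral_smul_const, integral_id,
    smul_zero, sub_zero, sub_zero] at hw
  -- The part with A u goes to the trapezoidal rule. The part with A(f - u) is the double integral,
  -- and its integrand is s k₀ up to 3Cτ².
  have hsum : f (t + τ) - u τ =
      (∫ s in (0 : ℝ)..τ, E τ s (app A (u s))) + ∫ s in (0 : ℝ)..τ, E τ s (v s - app A (u s)) := by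
    rw [hvoc τ hτm, ← intervalIntegral.integral_add htc hwi]
    refine intervalIntegral.integral_congr fun s _ => ?_
    simp only [map_sub, add_sub_cancel]
  have hu0 : evol B 0 (f t) = f t := hreg.evol_zero ⟨ht, by linarith⟩
  have hEτ : evolDeriv B 0 (f (t + τ)) = ContinuousLinearMap.id ℝ X :=
    hreg.evolDeriv_zero ⟨by linarith, htτ⟩
  simp only [sub_zero, add_zero, sub_self, hu0, hEτ, ContinuousLinearMap.id_apply] at htrap
  calc _ = ‖((∫ s in (0 : ℝ)..τ, E τ s (app A (u s))) -
          (τ / 2) • (evolDeriv B τ (f t) (app A (f t)) + app A (u τ))) +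
        ((∫ s in (0 : ℝ)..τ, E τ s (v s - app A (u s))) - ((τ ^ 2 - 0 ^ 2) / 2) • k₀)‖ := by
        change ‖f (t + τ) - u τ - _ - _‖ = _
        rw [hsum]
        congr 1
        module
    _ ≤ 2 * C * τ ^ 3 + 3 * C * τ ^ 2 * τ := norm_add_le_of_le htrap hw
    _ = _ := by ring

end exact

/-! ### Comparison of the frozen semigroup with the evolution of the nonlinear part -/

section frozen

variable {S R : C0Semigroup X} {A Bt : X →ₗ.[ℝ] X} {B : X → X →ₗ.[ℝ] X} {T C t τ : ℝ}
  {f : ℝ → X} {f₀ : X} {u : ℝ → X}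

theorem StepEstimates.nonneg (h : StepEstimates A B f t τ C f₀ Bt u) (hτ : 0 ≤ τ) : 0 ≤ C :=
  (norm_nonneg _).trans (h.second_deriv.2.2 0 ⟨le_rfl, hτ⟩)

variable [CompleteSpace X]

/-- The variation of constants formula for a solution of the nonlinear equation, compared with the
semigroup generated by a frozen operator. -/
theorem IsSolution.sub_eq_integral (hu : IsSolution B τ u) (hτ : 0 ≤ τ)
    (hmem : ∀ s ∈ Icc 0 τ, u s ∈ (B (u s) - R.generator).domain)
    (hψ : ContinuousOn (fun s => R.at' (τ - s) (app (B (u s) - R.generator) (u s))) (Icc 0 τ)) :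
    u τ - R.at' τ (u 0) =
      ∫ s in (0 : ℝ)..τ, R.at' (τ - s) (app (B (u s) - R.generator) (u s)) := by
  obtain ⟨M, -, hM⟩ := R.exists_norm_at'_le τ
  have hcont : ContinuousOn (fun s => R.at' (τ - s) (u s)) (Icc 0 τ) :=
    continuousOn_clm_apply_of_bounded (N := M) (fun s hs => hM _ (by linarith [hs.1]))
      (fun x => ((R.continuous_at' x).comp (continuous_const.sub continuous_id)).continuousOn)
      hu.continuousOn
  have h := intervalIntegral.integral_eq_sub_of_hasDeriv_right_of_le hτ hcont
    (f' := fun s => R.at' (τ - s) (app (B (u s) - R.generator) (u s))) (fun s hs => ?_)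
    (ContinuousOn.intervalIntegrable (by rwa [uIcc_of_le hτ]))
  · simpa using h.symm
  · have hs' : s ∈ Icc 0 τ := Ioo_subset_Icc_self hs
    rw [hasDerivWithinAt_Ioi_iff_tendsto, app_sub_op (hmem s hs')]
    have h1 := hasDerivWithinAt_Ioi_iff_tendsto.1 (hu.hasDerivWithinAt_Ioi ⟨hs.1.le, hs.2⟩)
    have h2 : R.HasGen (u s) (app R.generator (u s)) := C0Semigroup.hasGen_app (hmem s hs').2
    have h3 : Tendsto (fun r : ℝ => R.at' (τ - (s + r)) (app (B (u s)) (u s) -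
        app R.generator (u s))) (𝓝[>] 0) (𝓝 (R.at' (τ - s) (app (B (u s)) (u s) -
        app R.generator (u s)))) := by
      have : Continuous fun r : ℝ => R.at' (τ - (s + r)) (app (B (u s)) (u s) -
        app R.generator (u s)) :=
        (R.continuous_at' _).comp (continuous_const.sub (continuous_const_add s))
      simpa using (this.tendsto 0).mono_left (nhdsWithin_le_nhds (s := Ioi 0))
    have hN : ∀ᶠ r in 𝓝[>] (0 : ℝ), ‖R.at' (τ - (s + r))‖ ≤ M := by
      filter_upwards [self_mem_nhdsWithin] with r hr
      exact hM _ (by linarith [hs.1, mem_Ioi.1 hr])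
    refine (tendsto_clm_apply_of_bounded hN h3 (h1.sub h2)).congr' ?_
    -- Factoring out R(τ - s - r) leaves the difference quotient of u minus that of the orbit of
    -- u(s) under R.
    filter_upwards [Ioo_mem_nhdsGT (sub_pos.2 hs.2)] with r hr
    have e : R.at' (τ - s) (u s) = R.at' (τ - (s + r)) (R.at' r (u s)) := by
      rw [← R.at'_add (by linarith [hr.2]) hr.1.le]
      congr 2
      ring
    rw [e, ← smul_sub, map_smul, ← map_sub]
    congr 2
    change u (s + r) - u s - (R.at' r (u s) - u s) = _
    abel

/-- A and then A² pass under the variation of constants integral; its length τ gains one power over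
the bounds of the integrand. -/
theorem StepEstimates.hasGen_integral (h : StepEstimates S.generator B f t τ C f₀ R.generator u)
    (hR : ∀ s, expOp R.generator s = R.at' s) (hu : IsSolution B τ u) (hu0 : u 0 = f₀)
    (hτ : 0 ≤ τ) :
    ∃ y z, S.HasGen (u τ - R.at' τ f₀) y ∧ S.HasGen y z ∧ ‖y‖ ≤ C * τ ^ 2 ∧ ‖z‖ ≤ C * τ := by
  have hψ := h.second_deriv.continuousOn
  simp only [hR] at hψ
  have hψi : IntervalIntegrable (fun s => R.at' (τ - s) (app (B (u s) - R.generator) (u s)))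
      MeasureTheory.volume 0 τ := ContinuousOn.intervalIntegrable (by rwa [uIcc_of_le hτ])
  have hA : ∀ s ∈ Icc 0 τ, S.HasGen (R.at' (τ - s) (app (B (u s) - R.generator) (u s)))
      (app S.generator (R.at' (τ - s) (app (B (u s) - R.generator) (u s)))) ∧
      ‖app S.generator (R.at' (τ - s) (app (B (u s) - R.generator) (u s)))‖ ≤ C * τ ∧
      S.HasGen (app S.generator (R.at' (τ - s) (app (B (u s) - R.generator) (u s))))
        (app S.generator
          (app S.generator (R.at' (τ - s) (app (B (u s) - R.generator) (u s))))) ∧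
      ‖app S.generator
        (app S.generator (R.at' (τ - s) (app (B (u s) - R.generator) (u s))))‖ ≤ C :=
    fun s hs => by
    obtain ⟨h1, hn1⟩ := h.commute_one s hs
    obtain ⟨h2, hn2⟩ := h.commute_two s hs
    obtain ⟨h3, h3'⟩ := mem_opMul_domain.1 h1
    obtain ⟨-, h4'⟩ := mem_opMul_domain.1 h2
    rw [app_opMul h1, app_opMul h3] at hn1
    rw [app_opMul h2, app_opMul h1, app_opMul h3] at hn2
    rw [app_opMul h1, app_opMul h3] at h4'
    rw [app_opMul h3] at h3'
    simp only [app_total, ContinuousLinearMap.coe_coe, hR] at hn1 hn2 h3' h4'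
    exact ⟨C0Semigroup.hasGen_app h3', hn1, C0Semigroup.hasGen_app h4', hn2⟩
  obtain ⟨hi, hy⟩ := C0Semigroup.hasGen_integral hτ hψi
    (fun s hs => (hA s (Ioc_subset_Icc_self hs)).1)
    (fun s hs => (hA s (Ioc_subset_Icc_self hs)).2.1)
  obtain ⟨-, hz⟩ := C0Semigroup.hasGen_integral hτ hi
    (fun s hs => (hA s (Ioc_subset_Icc_self hs)).2.2.1)
    (fun s hs => (hA s (Ioc_subset_Icc_self hs)).2.2.2)
  rw [← hu.sub_eq_integral hτ h.second_deriv_mem hψ, hu0] at hy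
  refine ⟨_, _, hy, hz, ?_, ?_⟩
  · have := intervalIntegral.norm_integral_le_of_norm_le_const (a := 0) (b := τ)
      (f := fun s => app S.generator (R.at' (τ - s) (app (B (u s) - R.generator) (u s))))
      (C := C * τ) fun s hs => by
        rw [uIoc_of_le hτ] at hs
        exact (hA s (Ioc_subset_Icc_self hs)).2.1
    rw [sub_zero, abs_of_nonneg hτ] at this
    exact this.trans_eq (by ring)
  · have := intervalIntegral.norm_integral_le_of_norm_le_const (a := 0) (b := τ)
      (f := fun s => app S.generator
        (app S.generator (R.at' (τ - s) (app (B (u s) - R.generator) (u s)))))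
      (C := C) fun s hs => by
        rw [uIoc_of_le hτ] at hs
        exact (hA s (Ioc_subset_Icc_self hs)).2.2.2
    rwa [sub_zero, abs_of_nonneg hτ] at this

/-- The midpoint rule reduces the variation of constants integral to its value at τ/2. There R(τ/2)
is replaced by 1 through φ₁, then u(τ/2) by f₀ through R₁; what remains is -(τ/2) b up to O(τ²). The
factor 4 is 2 + 1/2 + 1/2 + 1. -/
theorem StepEstimates.norm_sub_add_opDeriv_le
    (h : StepEstimates A B f t τ C f₀ R.generator u)
    (hR : ∀ s, expOp R.generator s = R.at' s) (hu : IsSolution B τ u) (hu0 : u 0 = f₀)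
    (hτ : 0 < τ) :
    ‖u τ - R.at' τ f₀ + (τ ^ 2 / 2) • opDeriv B f₀ (app A f₀) f₀‖ ≤ 4 * C * τ ^ 3 := by
  have hC := h.nonneg hτ.le
  have hψ := h.second_deriv.continuousOn
  have hmid := h.second_deriv.norm_integral_sub_midpoint_le hτ.le
  simp only [hR] at hψ hmid
  rw [← hu.sub_eq_integral hτ.le h.second_deriv_mem hψ, hu0] at hmid
  set D := B (u (τ / 2)) - R.generator with hD
  set z := app D (u (τ / 2)) with hz
  set b := opDeriv B f₀ (app A f₀) f₀
  have hhalf : 0 ≤ τ / 2 := by linarith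
  rw [sub_half] at hmid
  have h1 : ‖R.at' (τ / 2) z - z‖ ≤ τ / 2 * (C * τ) := by
    obtain ⟨m1, hn⟩ := h.midpoint_one
    obtain ⟨m2, m3⟩ := mem_opMul_domain.1 m1
    rw [app_opMul m1, app_opMul m2, app_total] at hn
    rw [app_opMul m2, app_total] at m3
    have := (hasGen_phi_one hR hhalf z).app_eq
    rw [app_smul _ m3] at this
    rw [← this, norm_smul, Real.norm_of_nonneg hhalf]
    exact mul_le_mul_of_nonneg_left hn hhalf
  have h2 : ‖z - app D f₀‖ ≤ τ / 2 * (C * τ) := by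
    obtain ⟨m1, hn⟩ := h.midpoint_zero
    have hcd : ContDiffOn ℝ 1 u (Icc 0 (τ / 2)) := by
      have hu' : IsSolution B (τ / 2) u := hu.mono (by linarith)
      rw [contDiffOn_one_iff_derivWithin (uniqueDiffOn_Icc (by linarith))]
      refine ⟨fun s hs => (hu'.hasDeriv s hs).differentiableWithinAt,
        hu'.continuous_deriv.congr fun s hs => (hu'.hasDeriv s hs).derivWithin
          (uniqueDiffOn_Icc (by linarith) s hs)⟩
    have e := smul_taylorRem_one (by linarith : 0 < τ / 2) hcd
    rw [hu0] at e
    have m2 : u (τ / 2) ∈ D.domain := h.second_deriv_mem (τ / 2) ⟨hhalf, by linarith⟩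
    rw [hz, ← app_sub m2 h.order_zero_mem, ← e, app_smul _ m1, norm_smul,
      Real.norm_of_nonneg hhalf]
    exact mul_le_mul_of_nonneg_left hn hhalf
  have h3 : ‖app D f₀ + (τ / 2) • b‖ ≤ C * τ ^ 2 := h.order_zero
  have h4 : ‖τ • ((R.at' (τ / 2) z - z) + (z - app D f₀) + (app D f₀ + (τ / 2) • b))‖ ≤
      τ * (τ / 2 * (C * τ) + τ / 2 * (C * τ) + C * τ ^ 2) := by
    rw [norm_smul, Real.norm_of_nonneg hτ.le]
    exact mul_le_mul_of_nonneg_left (norm_add_le_of_le (norm_add_le_of_le h1 h2) h3) hτ.le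
  calc _ = ‖(u τ - R.at' τ f₀ - τ • R.at' (τ / 2) z) +
        τ • ((R.at' (τ / 2) z - z) + (z - app D f₀) + (app D f₀ + (τ / 2) • b))‖ := by
        congr 1
        module
    _ ≤ 2 * C * τ ^ 3 + τ * (τ / 2 * (C * τ) + τ / 2 * (C * τ) + C * τ ^ 2) :=
        norm_add_le_of_le hmid h4
    _ = _ := by ring

variable {x₁ x₂ : X}

/-- Both operators are expanded to second order at τ = 0. The first derivatives differ by (B(f₀) -
B̃) x₁, which is O(τ), and by the extra term b from the dependence of B on its argument. -/
theorem StepEstimates.norm_evolDeriv_sub_zero_le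
    (h : StepEstimates S.generator B f t τ C f₀ R.generator u)
    (hR : ∀ s, expOp R.generator s = R.at' s) (hτ : 0 < τ) (hx : S.HasGen f₀ x₁)
    (hE0 : evolDeriv B 0 f₀ = ContinuousLinearMap.id ℝ X)
    (hd : HasDerivWithinAt (fun r => evolDeriv B r f₀ x₁)
      (app (B f₀) x₁ + opDeriv B f₀ x₁ f₀) (Ici 0) 0) :
    ‖evolDeriv B τ f₀ x₁ - R.at' τ x₁ - τ • opDeriv B f₀ x₁ f₀‖ ≤ 3 * C * τ ^ 2 := by
  have h1 := h.rem_zero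
  have h2 := smul_taylorRem_two hτ h.rem_zero_smooth
  rw [hx.app_eq] at h1 h2
  have hd' := (hd.mono (Icc_subset_Ici_self : Icc 0 τ ⊆ Ici 0)).derivWithin
    (uniqueDiffOn_Icc hτ 0 ⟨le_rfl, hτ.le⟩)
  rw [hd', hE0, ContinuousLinearMap.id_apply] at h2
  obtain ⟨m1, hn1⟩ := h.order_one
  obtain ⟨-, m2⟩ := mem_opMul_domain.1 m1
  rw [app_opMul m1, hx.app_eq] at hn1
  rw [hx.app_eq] at m2
  rw [app_sub_op m2] at hn1
  have hBx : R.HasGen x₁ (app R.generator x₁) := C0Semigroup.hasGen_app m2.2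
  obtain ⟨m3, hn3⟩ := h.phi_zero
  obtain ⟨m4, m4'⟩ := mem_opMul_domain.1 m3
  obtain ⟨m5, m5'⟩ := mem_opMul_domain.1 m4
  rw [app_opMul m3, app_opMul m4, app_opMul m5, app_total, hx.app_eq] at hn3
  rw [app_opMul m4, app_opMul m5, app_total, hx.app_eq] at m4'
  rw [app_opMul m5, app_total, hx.app_eq] at m5'
  have h3 := (hasGen_phi_two hR hτ.le hBx).app_eq
  have h4 := ((R.hasGen_integral_orbit x₁ hτ.le).sub (hBx.smul τ)).app_eq
  rw [← h3, app_smul _ m5', app_smul _ m4'] at h4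
  calc _ = ‖τ ^ 2 • taylorRem 2 (fun r => evolDeriv B r f₀ x₁) τ
        - τ ^ 2 • app R.generator (app R.generator (phi R.generator τ 2 x₁))
        + τ • (app (B f₀) x₁ - app R.generator x₁)‖ := by
        rw [h2, h4]
        congr 1
        module
    _ ≤ τ ^ 2 * C + τ ^ 2 * C + τ * (C * τ) := by
        refine norm_add_le_of_le (norm_sub_le_of_le ?_ ?_) ?_ <;> rw [norm_smul]
        · rw [Real.norm_of_nonneg (sq_nonneg τ)]
          exact mul_le_mul_of_nonneg_left h1 (sq_nonneg τ)
        · rw [Real.norm_of_nonneg (sq_nonneg τ)]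
          exact mul_le_mul_of_nonneg_left hn3 (sq_nonneg τ)
        · rw [Real.norm_of_nonneg hτ.le]
          exact mul_le_mul_of_nonneg_left hn1 hτ.le
    _ = _ := by ring

/-- Both terms equal x₂ at τ = 0, and each first order remainder is bounded. -/
theorem StepEstimates.norm_evolDeriv_sub_one_le
    (h : StepEstimates S.generator B f t τ C f₀ R.generator u)
    (hR : ∀ s, expOp R.generator s = R.at' s) (hτ : 0 < τ) (hx : S.HasGen f₀ x₁)
    (hx₁ : S.HasGen x₁ x₂) (hE0 : evolDeriv B 0 f₀ = ContinuousLinearMap.id ℝ X) :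
    ‖evolDeriv B τ f₀ x₂ - R.at' τ x₂‖ ≤ 2 * C * τ := by
  have e : app (S.generator ⬝ₒ S.generator) f₀ = x₂ := by
    rw [app_opMul h.rem_one_mem, hx.app_eq, hx₁.app_eq]
  have h1 := h.rem_one
  have h2 := smul_taylorRem_one hτ h.rem_one_smooth
  rw [e] at h1 h2
  rw [hE0, ContinuousLinearMap.id_apply] at h2
  obtain ⟨m1, hn1⟩ := h.phi_one
  obtain ⟨m2, m2'⟩ := mem_opMul_domain.1 m1
  rw [app_opMul m1, app_opMul m2, app_total, e] at hn1
  rw [app_opMul m2, app_total, e] at m2'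
  have h3 := (hasGen_phi_one hR hτ.le x₂).app_eq
  rw [app_smul _ m2'] at h3
  calc _ = ‖τ • taylorRem 1 (fun r => evolDeriv B r f₀ x₂) τ -
        τ • app R.generator (phi R.generator τ 1 x₂)‖ := by
        rw [h2, h3]
        congr 1
        abel
    _ ≤ τ * C + τ * C := by
        refine norm_sub_le_of_le ?_ ?_ <;> rw [norm_smul, Real.norm_of_nonneg hτ.le]
        · exact mul_le_mul_of_nonneg_left h1 hτ.le
        · exact mul_le_mul_of_nonneg_left hn1 hτ.le
    _ = _ := by ring

theorem StepEstimates.norm_linear_evolDeriv_sub_le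
    (h : StepEstimates S.generator B f t τ C f₀ R.generator u)
    (hR : ∀ s, expOp R.generator s = R.at' s) (hτ : 0 < τ) (hx : S.HasGen f₀ x₁)
    (hE0 : evolDeriv B 0 f₀ = ContinuousLinearMap.id ℝ X) {y z : X}
    (hy : S.HasGen (evolDeriv B τ f₀ x₁) y) (hz : S.HasGen (R.at' τ x₁) z) :
    ‖y - z‖ ≤ 2 * C * τ := by
  obtain ⟨m1, h1⟩ := h.rem_two
  have h2 := smul_taylorRem_one hτ (h.rem_zero_smooth.of_le one_le_two)
  rw [hx.app_eq] at m1 h1 h2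
  rw [hE0, ContinuousLinearMap.id_apply] at h2
  obtain ⟨m2, hn2⟩ := h.phi_two
  obtain ⟨m3, m3'⟩ := mem_opMul_domain.1 m2
  obtain ⟨m4, m4'⟩ := mem_opMul_domain.1 m3
  rw [app_opMul m2, app_opMul m3, app_opMul m4, app_total, hx.app_eq] at hn2
  rw [app_opMul m3, app_opMul m4, app_total, hx.app_eq] at m3'
  rw [app_opMul m4, app_total, hx.app_eq] at m4'
  have h3 := (hasGen_phi_one hR hτ.le x₁).app_eq
  rw [app_smul _ m4'] at h3
  have g1 := (C0Semigroup.hasGen_app m1).smul τ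
  have g2 := (C0Semigroup.hasGen_app m3').smul τ
  rw [h2] at g1
  rw [h3] at g2
  have g3 := g1.sub g2
  -- The common value x₁ cancels before A is applied, so A x₁ is not needed.
  rw [sub_sub_sub_cancel_right] at g3
  rw [(hy.sub hz).unique g3]
  calc _ ≤ τ * C + τ * C := by
        refine norm_sub_le_of_le ?_ ?_ <;> rw [norm_smul, Real.norm_of_nonneg hτ.le]
        · exact mul_le_mul_of_nonneg_left h1 hτ.le
        · exact mul_le_mul_of_nonneg_left hn2 hτ.le
    _ = _ := by ring

end frozen

/-- The local error of the Strang splitting. -/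
theorem norm_sub_strang_le [CompleteSpace X] {S : C0Semigroup X} {B : X → X →ₗ.[ℝ] X} {T C M : ℝ} {f : ℝ → X}
    (hS : ∀ t, expOp S.generator t = S.at' t) (hM : ∀ t ≤ 1, ‖S.at' t‖ ≤ M)
    (hB : ∀ t ∈ Icc 0 T, Generates (B (f t)))
    (hf : IsSolution (fun v => S.generator + B v) T f)
    (hreg : RegularAlong S.generator B T f)
    (hest : ∀ t τ : ℝ, 0 ≤ t → 0 < τ → t + τ ≤ T → Estimates S.generator B f t τ C)
    {t τ : ℝ} (ht : 0 ≤ t) (hτ : 0 < τ) (htτ : t + τ ≤ T) :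
    ‖f (t + τ) - strang S.generator B τ (f (t + τ / 2)) (f t)‖ ≤ (13 + M ^ 3) * C * τ ^ 3 := by
  have htT : t ∈ Icc 0 T := ⟨ht, by linarith⟩
  obtain ⟨R, hRB, hR⟩ := (hB (t + τ / 2) ⟨by linarith, by linarith⟩).exists_semigroup
  have h := hest t τ ht hτ htτ
  have hker := fun s σ => cubature_kernel hreg ht hτ htτ h (s := s) (σ := σ)
  rw [Estimates, ← hRB] at h
  rw [← hRB] at hR
  have hτm : τ ∈ Icc 0 τ := ⟨hτ.le, le_rfl⟩
  have hE0 := hreg.evolDeriv_zero htT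
  have hEτ := hreg.evolDeriv_zero (s := t + τ) ⟨by linarith, htτ⟩
  have hu0 : evol B 0 (f t) = f t := hreg.evol_zero htT
  have hu : IsSolution B τ (fun s => evol B s (f t)) :=
    isSolution_evol (hreg.wellPosed τ t hτ.le ht (by linarith))
  obtain ⟨x₁, x₂, y₀₁, y₀₂, y₁₁, hx₁, hx₂, hy₀₁, hy₀₂, hy₁₁, hstrang⟩ :=
    norm_strang_step_le hS hR hτ.le hM h.third_order_splitting
  have hexact := norm_exact_step_le hreg hf hest ht hτ htτ
  -- The corners (τ, τ) and (τ, 0) of the kernel are A² u(τ) and A ∂₂E_B(τ, f₀) A f₀; both are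
  -- compared with the corner (0, 0).
  obtain ⟨m1, m2, k1⟩ := hker τ τ hτ.le le_rfl le_rfl
  obtain ⟨-, m3, k2⟩ := hker τ 0 le_rfl hτ.le le_rfl
  simp only [sub_self, sub_zero, add_zero, hEτ, ContinuousLinearMap.id_apply, hu0,
    hx₁.app_eq, hx₂.app_eq] at m2 k1 m3 k2 hexact
  obtain ⟨y, z, hy, hz, hyn, hzn⟩ := h.hasGen_integral hR hu hu0 hτ.le
  have ey := ((C0Semigroup.hasGen_app m1).sub hy₀₁).unique hy
  rw [← ey] at hz hyn
  have ez := ((C0Semigroup.hasGen_app m2).sub hy₀₂).unique hz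
  rw [← ez] at hzn
  have ha := h.norm_sub_add_opDeriv_le hR hu hu0 hτ
  have hc := h.norm_evolDeriv_sub_zero_le hR hτ hx₁ hE0 (by
    have := hreg.hasDerivWithinAt_evolDeriv ht (by linarith)
    rwa [hx₁.app_eq] at this)
  have he := h.norm_linear_evolDeriv_sub_le hR hτ hx₁ hE0 (C0Semigroup.hasGen_app m3) hy₁₁
  have hff := h.norm_evolDeriv_sub_one_le hR hτ hx₁ hx₂ hE0
  rw [hx₁.app_eq] at ha
  simp only [strang, hS, ← hRB, hR]
  set b := opDeriv B (f t) x₁ (f t)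
  set F := f (t + τ)
  set U := evol B τ (f t)
  set AU := app S.generator U
  set AAU := app S.generator AU
  set E₁ := evolDeriv B τ (f t) x₁
  set AE₁ := app S.generator E₁
  set E₂ := evolDeriv B τ (f t) x₂
  set R₀ := R.at' τ (f t)
  set R₁ := R.at' τ x₁
  set R₂ := R.at' τ x₂
  set Z := S.at' (τ / 2) (R.at' τ (S.at' (τ / 2) (f t)))
  have hτ2 : 0 ≤ τ / 2 := by linarith
  have hτ8 : 0 ≤ τ ^ 2 / 8 := by positivity
  -- The terms in b cancel between the third and fourth summands, and the weights 1, 2, 1 in the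
  -- last one turn τ²/8 into the τ²/2 of the exact expansion.
  have key : F - Z = (F - U - (τ / 2) • (E₁ + AU) - (τ ^ 2 / 2) • E₂)
      - (Z - R₀ - (τ / 2) • (y₀₁ + R₁) - (τ ^ 2 / 8) • (y₀₂ + (2 : ℝ) • y₁₁ + R₂))
      + (U - R₀ + (τ ^ 2 / 2) • b)
      + (τ / 2) • ((E₁ - R₁ - τ • b) + (AU - y₀₁))
      + (τ ^ 2 / 8) • ((AAU - y₀₂) + (2 : ℝ) • (AE₁ - y₁₁) + (E₂ - R₂)
        - (AAU - E₂) - (2 : ℝ) • (AE₁ - E₂)) := by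
    module
  have b1 : ‖(τ / 2) • ((E₁ - R₁ - τ • b) + (AU - y₀₁))‖ ≤
      τ / 2 * (3 * C * τ ^ 2 + C * τ ^ 2) := by
    rw [norm_smul, Real.norm_of_nonneg hτ2]
    exact mul_le_mul_of_nonneg_left (norm_add_le_of_le hc hyn) hτ2
  have b2 : ‖(τ ^ 2 / 8) • ((AAU - y₀₂) + (2 : ℝ) • (AE₁ - y₁₁) + (E₂ - R₂)
        - (AAU - E₂) - (2 : ℝ) • (AE₁ - E₂))‖ ≤
      τ ^ 2 / 8 * (C * τ + 2 * (2 * C * τ) + 2 * C * τ + 2 * C * τ + 2 * (2 * C * τ)) := by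
    rw [norm_smul, Real.norm_of_nonneg hτ8]
    have two : ∀ {w : X} {c : ℝ}, ‖w‖ ≤ c → ‖(2 : ℝ) • w‖ ≤ 2 * c := fun {w c} hw => by
      rw [norm_smul, Real.norm_of_nonneg zero_le_two]
      linarith
    exact mul_le_mul_of_nonneg_left (norm_sub_le_of_le (norm_sub_le_of_le (norm_add_le_of_le
      (norm_add_le_of_le hzn (two he)) hff) k1) (two k2)) hτ8
  rw [key]
  refine (norm_add_le_of_le (norm_add_le_of_le (norm_add_le_of_le (norm_sub_le_of_le hexact
    hstrang) ha) b1) b2).trans ?_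
  -- The contributions besides M³ are 5 + 4 + 2 + 13/8, which is at most 13.
  have hC : 0 ≤ C * τ ^ 3 := mul_nonneg (h.nonneg hτ.le) (by positivity)
  nlinarith

end StrangSplitting

open StrangSplitting in
theorem theorem3p6 {X : Type*} [NormedAddCommGroup X] [NormedSpace ℝ X] [CompleteSpace X]
    (A : X →ₗ.[ℝ] X) (B : X → X →ₗ.[ℝ] X) (T : ℝ) (f : ℝ → X)
    (hA : Generates A)
    (hB : ∀ t ∈ Set.Icc 0 T, Generates (B (f t)))
    (hf : IsSolution (fun v => A + B v) T f)
    (hreg : RegularAlong A B T f)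
    (hest : ∃ C : ℝ, ∀ t τ : ℝ, 0 ≤ t → 0 < τ → t + τ ≤ T → Estimates A B f t τ C) :
    ConsistentOfOrder 2 A B T f := by
  obtain ⟨C, hest⟩ := hest
  obtain ⟨S, rfl, hS⟩ := hA.exists_semigroup
  obtain ⟨M, -, hM⟩ := S.exists_norm_at'_le 1
  exact ⟨(13 + M ^ 3) * C, fun τ k hτ hk =>
    norm_sub_strang_le hS hM hB hf hreg hest (by positivity) hτ hk⟩
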